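/- Let $\Bbbk$ be an algebraically closed field of characteristic $0$, $\theta\ge 0$ an integer, $\mathbb I=\{1,\dots,\theta\}$, and let $\Gamma,\Lambda$ be abelian groups. Let $q_{ij}\in\Bbbk^\times$, $g_i\in\Gamma$, $h_i\in\Lambda$ and characters $\gamma_i:\Gamma\to\Bbbk^\times$, $\lambda_i:\Lambda\to\Bbbk^\times$ ($i,j\in\mathbb I$) be given, and let $\overline\mu:\Gamma\times\Lambda\to\Bbbk^\times$ be $\mathbb Z$-bilinear, such that $$\gamma_j(g_i)=q_{ij},\quad \lambda_j(h_i)=q_{ji},\quad \overline\mu(g_i,h_j)=q_{ij},\quad \gamma_i(g)=\overline\mu(g,h_i),\quad \lambda_i(h)=\overline\mu(g_i,h)$$ for all $i,j\in\mathbb I$, $g\in\Gamma$, $h\in\Lambda$. Let $V$ be the Yetter–Drinfeld module over $\Bbbk\Gamma$ with basis $E_1,\dots,E_\theta$, action $g\cdot E_i=\gamma_i(g)E_i$ and coaction $E_i\mapsto g_i\otimes E_i$; let $W$ be the Yetter–Drinfeld module over $\Bbbk\Lambda$ with basis $F_1,\dots,F_\theta$, action $h\cdot F_i=\lambda_i(h)F_i$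 and coaction $F_i\mapsto h_i\otimes F_i$. Let $\mathcal B(V)=T(V)/\mathcal I(V)$ be the Nichols algebra, where $\mathcal I(V)$ is the sum of all two-sided ideals of the braided Hopf algebra $T(V)$ that are generated by homogeneous elements of degree $\ge 2$ and are coideals and Yetter–Drinfeld submodules; similarly $\mathcal B(W)$. The bosonization $T(V)\#\Bbbk\Gamma$ is the Hopf algebra generated by $T(V)$ and $\Bbbk\Gamma$ with $gE_i=\gamma_i(g)E_ig$, $\Delta(g)=g\otimes g$, $\Delta(E_i)=E_i\otimes 1+g_i\otimes E_i$. Put $$\mathcal A=T(V)\#\Bbbk\Gamma,\quad \mathcal A'=(T(W)\#\Bbbk\Lambda)^{\mathrm{cop}},\quad \mathcal B=\mathcal B(V)\#\Bbbk\Gamma,\quad \mathcal B'=(\mathcal B(W)\#\Bbbk\Lambda)^{\mathrm{cop}},$$ with canonical Hopf algebra surjections $\pi_V:\mathcal A\to\mathcal B$, $\pi_W:\mathcal A'\to\mathcal B'$. A skew-Hopf pairing of Hopf algebras $A,B$ with bijective antipodes is a bilinear form $\mu:A\times B\to\Bbbk$ with $\mu(1,b)=\varepsilon(b)$, $\mu(a,1)=\varepsilon(a)$,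 $\mu(aa',b)=\mu(a,b_{(2)})\mu(a',b_{(1)})$, $\mu(a,bb')=\mu(a_{(1)},b)\mu(a_{(2)},b')$ and $\mu(\mathcal S(a),\mathcal S(b))=\mu(a,b)$. (The last identity is equivalent to $\mu(\mathcal S(a),b)=\mu(a,\mathcal S^{-1}(b))$.) There is a unique skew-Hopf pairing $\mu:\mathcal A\otimes\mathcal A'\to\Bbbk$ such that $$\mu(g,h)=\overline\mu(g,h),\quad \mu(E_i,F_j)=-\delta_{ij},\quad \mu(E_i,h)=\mu(g,F_i)=0,\quad \mu(Eg,Fh)=\mu(E,F)\,\mu(g,h)$$ for all $i,j\in\mathbb I$, $g\in\Gamma$, $h\in\Lambda$, $E\in T(V)$, $F\in T(W)$. **Theorem.** There is a unique bilinear form $\nu:\mathcal B\times\mathcal B'\to\Bbbk$ with $\nu(\pi_V(a),\pi_W(b))=\mu(a,b)$ for all $a\in\mathcal A$, $b\in\mathcal A'$. It is a skew-Hopf pairing. Its restriction to $\mathcal B(V)\times\mathcal B(W)$ is non-degenerate, and $\nu$ is non-degenerate if and only if $\overline\mu$ is non-degenerate, that is: $\overline\mu(g,h)=1$ for all $h\in\Lambda$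 only for $g=1$, and $\overline\mu(g,h)=1$ for all $g\in\Gamma$ only for $h=1$. -/

import Mathlib

open scoped TensorProduct

noncomputable section

namespace SkewPairing

/-- A Yetter-Drinfeld module of diagonal type over the group algebra `k[Γ]` of an abelian group:
the vector space with basis `(E i)`, where `E i` has coaction `E i ↦ grp i ⊗ E i` and
action `g • E i = char i g • E i`. -/
structure DiagonalYD (k Γ ι : Type*) [Field k] [CommGroup Γ] where
  grp : ι → Γ
  char : ι → Γ →* kˣ

variable {k Γ ι : Type*} [Field k] [CommGroup Γ]

/-- The tensor algebra `T(V)` of the Yetter-Drinfeld module `V` with basis indexed by `ι`. -/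
def TV (_D : DiagonalYD k Γ ι) : Type _ := TensorAlgebra k (ι →₀ k)

instance (D : DiagonalYD k Γ ι) : Ring (TV D) := inferInstanceAs (Ring (TensorAlgebra k (ι →₀ k)))

instance (D : DiagonalYD k Γ ι) : Algebra k (TV D) :=
  inferInstanceAs (Algebra k (TensorAlgebra k (ι →₀ k)))

section TensorAlg

variable (D : DiagonalYD k Γ ι)

/-- The inclusion `V → T(V)`. -/
def incl : (ι →₀ k) →ₗ[k] TV D := TensorAlgebra.ι k

/-- The basis element `E i` of `V`, inside `T(V)`. -/
def E (i : ι) : TV D := incl D (Finsupp.single i 1)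

/-- The algebra map out of `T(V)` with prescribed values on the basis of `V`. -/
def liftE {A : Type*} [Ring A] [Algebra k A] (f : ι → A) : TV D →ₐ[k] A :=
  TensorAlgebra.lift k (Finsupp.linearCombination k f)

variable {D}

@[simp] theorem liftE_E {A : Type*} [Ring A] [Algebra k A] (f : ι → A) (i : ι) :
    liftE D f (E D i) = f i := by
  have h := TensorAlgebra.lift_ι_apply (Finsupp.linearCombination k f) (Finsupp.single i 1)
  rw [Finsupp.linearCombination_single, one_smul] at h
  exact h

theorem TV_hom_ext {A : Type*} [Ring A] [Algebra k A] {f g : TV D →ₐ[k] A}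
    (h : ∀ i, f (E D i) = g (E D i)) : f = g := by
  apply TensorAlgebra.hom_ext
  apply Finsupp.lhom_ext'
  intro i
  ext
  exact h i

/-- Induction on words. -/
theorem TV_mem {M : Submodule k (TV D)} (h1 : (1 : TV D) ∈ M)
    (hE : ∀ i, ∀ t ∈ M, E D i * t ∈ M) (t : TV D) : t ∈ M := by
  have key : ∀ a : TV D, ∀ t ∈ M, a * t ∈ M := by
    intro a
    refine TensorAlgebra.induction (R := k) (M := ι →₀ k)
      (C := fun a => ∀ t ∈ M, (show TV D from a) * t ∈ M) ?_ ?_ ?_ ?_ a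
    · intro r t ht
      have : (algebraMap k (TV D) r) * t = r • t := (Algebra.smul_def r t).symm
      exact this ▸ M.smul_mem r ht
    · intro x t ht
      induction x using Finsupp.induction_linear with
      | zero =>
        have : incl D 0 * t = 0 := by rw [map_zero, zero_mul]
        exact (show incl D 0 * t ∈ M from this ▸ M.zero_mem)
      | add f g hf hg =>
        have : incl D (f + g) * t = incl D f * t + incl D g * t := by rw [map_add, add_mul]
        exact (show incl D (f + g) * t ∈ M from this ▸ M.add_mem hf hg)
      | single i c =>
        have : incl D (Finsupp.single i c) * t = c • (E D i * t) := by
          rw [E, ← smul_mul_assoc, ← map_smul, Finsupp.smul_single, smul_eq_mul, mul_one]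
        exact (show incl D (Finsupp.single i c) * t ∈ M from
          this ▸ M.smul_mem c (hE i t ht))
    · intro a b ha hb t ht
      have : (show TV D from a * b) * t = (show TV D from a) * ((show TV D from b) * t) :=
        mul_assoc (G := TV D) _ _ _
      exact this ▸ ha _ (hb t ht)
    · intro a b ha hb t ht
      have : (show TV D from a + b) * t = (show TV D from a) * t + (show TV D from b) * t :=
        add_mul (R := TV D) _ _ _
      exact this ▸ M.add_mem (ha t ht) (hb t ht)
  simpa using key t 1 h1

variable (D)

/-- The action of `g : Γ` on `T(V)` by algebra maps. -/
def act (g : Γ) : TV D →ₐ[k] TV D := liftE D fun i => (D.char i g : k) • E D i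

instance : MulSemiringAction Γ (TV D) where
  smul g t := act D g t
  one_smul t := by
    change act D 1 t = AlgHom.id k _ t
    congr 1
    exact TV_hom_ext fun i => by simp [act]
  mul_smul g h t := by
    change act D (g * h) t = ((act D g).comp (act D h)) t
    congr 1
    exact TV_hom_ext fun i => by simp [act, smul_smul, mul_comm]
  smul_zero g := map_zero (act D g)
  smul_add g := map_add (act D g)
  smul_one g := map_one (act D g)
  smul_mul g := map_mul (act D g)

theorem act_def (g : Γ) (t : TV D) : g • t = act D g t := rfl

instance : SMulCommClass Γ k (TV D) where
  smul_comm g c t := map_smul (act D g) c t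

@[simp] theorem smul_E (g : Γ) (i : ι) : g • E D i = (D.char i g : k) • E D i := by
  simp [act_def, act]

/-- The coaction `T(V) → k[Γ] ⊗ T(V)`. -/
def coact : TV D →ₐ[k] MonoidAlgebra k Γ ⊗[k] TV D :=
  liftE D fun i => MonoidAlgebra.of k Γ (D.grp i) ⊗ₜ E D i

/-- The counit of `T(V)`. -/
def tcounit : TV D →ₐ[k] k := liftE D fun _ => 0

/-- Left multiplication by the primitive element `E i ⊗ 1 + 1 ⊗ E i` in the braided tensor
product algebra of `T(V)` with itself, in which `(1 ⊗ E i) (x ⊗ y) = (grp i • x) ⊗ (E i * y)`. -/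
def braidedMulLeft (i : ι) : Module.End k (TV D ⊗[k] TV D) :=
  TensorProduct.map (LinearMap.mulLeft k (E D i)) LinearMap.id +
    TensorProduct.map (act D (D.grp i)).toLinearMap (LinearMap.mulLeft k (E D i))

/-- The coproduct of the braided Hopf algebra `T(V)`: the algebra map to the braided tensor product
`T(V) ⊗ T(V)` for which the elements of `V` are primitive. It sends `E i₁ * ⋯ * E iₙ` to the
product of the elements `E iⱼ ⊗ 1 + 1 ⊗ E iⱼ`. -/
def braidedComul : TV D →ₗ[k] TV D ⊗[k] TV D :=
  (LinearMap.applyₗ ((1 : TV D) ⊗ₜ[k] (1 : TV D))) ∘ₗ (liftE D (braidedMulLeft D)).toLinearMap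

theorem braidedComul_one : braidedComul D 1 = 1 ⊗ₜ 1 := by simp [braidedComul]

theorem braidedComul_E_mul (i : ι) (t : TV D) :
    braidedComul D (E D i * t) = braidedMulLeft D i (braidedComul D t) := by
  simp [braidedComul]

@[simp] theorem braidedMulLeft_tmul (i : ι) (x y : TV D) :
    braidedMulLeft D i (x ⊗ₜ y) = (E D i * x) ⊗ₜ y + (D.grp i • x) ⊗ₜ (E D i * y) := by
  simp [braidedMulLeft, act_def]

/-- The homogeneous component of degree `n` of `T(V)`. -/
def homog (n : ℕ) : Submodule k (TV D) := LinearMap.range (incl D) ^ n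

/-- The defining property of the ideals whose sum is the defining ideal of the Nichols algebra:
two-sided ideals generated by homogeneous elements of degree at least two, that are
Yetter-Drinfeld submodules and coideals for the braided coproduct. -/
structure IsNicholsCandidate (I : Ideal (TV D)) : Prop where
  twoSided : I.IsTwoSided
  graded : I.restrictScalars k ≤ ⨆ n : ℕ, ⨆ _ : 2 ≤ n, I.restrictScalars k ⊓ homog D n
  act_mem : ∀ (g : Γ), ∀ x ∈ I, g • x ∈ I
  coact_mem : ∀ x ∈ I, coact D x ∈
    Submodule.map₂ (TensorProduct.mk k (MonoidAlgebra k Γ) (TV D)) ⊤ (I.restrictScalars k)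
  coideal : ∀ x ∈ I, braidedComul D x ∈
    Submodule.map₂ (TensorProduct.mk k (TV D) (TV D)) (I.restrictScalars k) ⊤ ⊔
      Submodule.map₂ (TensorProduct.mk k (TV D) (TV D)) ⊤ (I.restrictScalars k)

/-- The defining ideal `I(V)` of the Nichols algebra of `V`. -/
def nicholsIdeal : Ideal (TV D) := sSup {I | IsNicholsCandidate D I}

theorem nicholsIdeal_induction {p : TV D → Prop} (h0 : p 0)
    (hadd : ∀ x y, p x → p y → p (x + y))
    (h : ∀ I, IsNicholsCandidate D I → ∀ x ∈ I, p x) {x : TV D} (hx : x ∈ nicholsIdeal D) : p x := by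
  rw [nicholsIdeal, sSup_eq_iSup'] at hx
  exact Submodule.iSup_induction _ (motive := p) hx (fun I x hx => h I.1 I.2 x hx) h0 hadd

theorem IsNicholsCandidate.le {D : DiagonalYD k Γ ι} {I : Ideal (TV D)}
    (h : IsNicholsCandidate D I) : I ≤ nicholsIdeal D :=
  le_sSup (a := I) h

instance : (nicholsIdeal D).IsTwoSided where
  mul_mem_of_left b hx := by
    refine nicholsIdeal_induction D (p := fun x => x * b ∈ nicholsIdeal D) ?_ ?_ ?_ hx
    · simp
    · intro x y hx hy
      rw [add_mul]
      exact add_mem hx hy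
    · intro I hI x hx
      have := hI.twoSided
      exact hI.le (I.mul_mem_right b hx)

theorem homog_tcounit {n : ℕ} (hn : 1 ≤ n) {x : TV D} (hx : x ∈ homog D n) : tcounit D x = 0 := by
  obtain ⟨m, rfl⟩ := Nat.exists_eq_add_of_le' hn
  rw [homog, pow_succ] at hx
  refine Submodule.mul_induction_on hx ?_ ?_
  · rintro a - _ ⟨v, rfl⟩
    have : tcounit D (incl D v) = 0 := by
      induction v using Finsupp.induction_linear with
      | zero => simp
      | add f g hf hg => simp [hf, hg]
      | single i c =>
        have : incl D (Finsupp.single i c) = c • E D i := by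
          rw [E, ← map_smul, Finsupp.smul_single, smul_eq_mul, mul_one]
        rw [this, map_smul, tcounit, liftE_E, smul_zero]
    rw [map_mul, this, mul_zero]
  · intro x y hx hy
    rw [map_add, hx, hy, add_zero]

/-- The sum of the candidates is again a candidate. -/
theorem nicholsIdeal_isNicholsCandidate : IsNicholsCandidate D (nicholsIdeal D) where
  twoSided := inferInstance
  graded := by
    intro x hx
    refine nicholsIdeal_induction D ?_ ?_ ?_ hx
    · exact zero_mem _
    · exact fun x y hx hy => add_mem hx hy
    · intro I hI x hx
      exact (iSup_mono fun n => iSup_mono fun _ => inf_le_inf_right _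
        (Submodule.restrictScalars_mono k hI.le)) (hI.graded hx)
  act_mem g x hx := by
    refine nicholsIdeal_induction D (p := fun x => g • x ∈ nicholsIdeal D) ?_ ?_ ?_ hx
    · simp
    · intro x y hx hy
      rw [smul_add]
      exact add_mem hx hy
    · exact fun I hI x hx => hI.le (hI.act_mem g x hx)
  coact_mem x hx := by
    refine nicholsIdeal_induction D (p := fun x => coact D x ∈
      Submodule.map₂ (TensorProduct.mk k (MonoidAlgebra k Γ) (TV D)) ⊤
        ((nicholsIdeal D).restrictScalars k)) ?_ ?_ ?_ hx
    · rw [map_zero]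
      exact zero_mem _
    · intro x y hx hy
      rw [map_add]
      exact add_mem hx hy
    · intro I hI x hx
      exact Submodule.map₂_le_map₂_right (Submodule.restrictScalars_mono k hI.le)
        (hI.coact_mem x hx)
  coideal x hx := by
    refine nicholsIdeal_induction D (p := fun x => braidedComul D x ∈
      Submodule.map₂ (TensorProduct.mk k (TV D) (TV D)) ((nicholsIdeal D).restrictScalars k) ⊤ ⊔
        Submodule.map₂ (TensorProduct.mk k (TV D) (TV D)) ⊤
          ((nicholsIdeal D).restrictScalars k)) ?_ ?_ ?_ hx
    · rw [map_zero]
      exact zero_mem _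
    · intro x y hx hy
      rw [map_add]
      exact add_mem hx hy
    · intro I hI x hx
      refine SetLike.le_def.1 (sup_le_sup ?_ ?_) (hI.coideal x hx)
      · exact Submodule.map₂_le_map₂_left (Submodule.restrictScalars_mono k hI.le)
      · exact Submodule.map₂_le_map₂_right (Submodule.restrictScalars_mono k hI.le)

/-- The Nichols algebra `B(V) = T(V) / I(V)`. -/
def Nichols : Type _ := TV D ⧸ nicholsIdeal D

instance : Ring (Nichols D) := inferInstanceAs (Ring (TV D ⧸ nicholsIdeal D))

instance : Algebra k (Nichols D) := inferInstanceAs (Algebra k (TV D ⧸ nicholsIdeal D))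

/-- The canonical projection `T(V) → B(V)`. -/
def toNichols : TV D →ₐ[k] Nichols D := Ideal.Quotient.mkₐ k (nicholsIdeal D)

theorem toNichols_surjective : Function.Surjective (toNichols D) :=
  Ideal.Quotient.mkₐ_surjective k _

theorem toNichols_eq_zero {x : TV D} : toNichols D x = 0 ↔ x ∈ nicholsIdeal D :=
  Ideal.Quotient.eq_zero_iff_mem

end TensorAlg

/-- An algebra map descends along a surjective algebra map. -/
def descend {A B C : Type*} [Ring A] [Ring B] [Ring C] [Algebra k A] [Algebra k B] [Algebra k C]
    (p : A →ₐ[k] B) (hp : Function.Surjective p) (f : A →ₐ[k] C)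
    (h : ∀ a, p a = 0 → f a = 0) : B →ₐ[k] C :=
  have key : ∀ a a', p a = p a' → f a = f a' := fun a a' haa => by
    rw [← sub_eq_zero, ← map_sub]
    exact h _ (by rw [map_sub, haa, sub_self])
  have hs := Function.surjInv_eq hp
  { toFun := fun b => f (Function.surjInv hp b)
    map_one' := (key _ 1 (by rw [hs, map_one])).trans (map_one f)
    map_zero' := (key _ 0 (by rw [hs, map_zero])).trans (map_zero f)
    map_mul' := fun x y => (key _ (Function.surjInv hp x * Function.surjInv hp y)
      (by rw [hs, map_mul, hs, hs])).trans (map_mul f _ _)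
    map_add' := fun x y => (key _ (Function.surjInv hp x + Function.surjInv hp y)
      (by rw [hs, map_add, hs, hs])).trans (map_add f _ _)
    commutes' := fun c => (key _ (algebraMap k A c) (by rw [hs, p.commutes])).trans (f.commutes c) }

theorem descend_apply {A B C : Type*} [Ring A] [Ring B] [Ring C] [Algebra k A] [Algebra k B]
    [Algebra k C] (p : A →ₐ[k] B) (hp : Function.Surjective p) (f : A →ₐ[k] C)
    (h : ∀ a, p a = 0 → f a = 0) (a : A) : descend p hp f h (p a) = f a := by
  change f _ = f a
  rw [← sub_eq_zero, ← map_sub]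
  exact h _ (by rw [map_sub, Function.surjInv_eq hp, sub_self])

/-- The action of `g : Γ` on `B(V)` by algebra maps. -/
def nicholsAct (D : DiagonalYD k Γ ι) (g : Γ) : Nichols D →ₐ[k] Nichols D :=
  descend (toNichols D) (toNichols_surjective D) ((toNichols D).comp (act D g))
    fun a ha => (toNichols_eq_zero D).2
      ((nicholsIdeal_isNicholsCandidate D).act_mem g a ((toNichols_eq_zero D).1 ha))

theorem nicholsAct_toNichols (D : DiagonalYD k Γ ι) (g : Γ) (t : TV D) :
    nicholsAct D g (toNichols D t) = toNichols D (g • t) := descend_apply ..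

instance (D : DiagonalYD k Γ ι) : MulSemiringAction Γ (Nichols D) where
  smul g b := nicholsAct D g b
  one_smul b := by
    obtain ⟨a, rfl⟩ := toNichols_surjective D b
    change nicholsAct D 1 (toNichols D a) = _
    rw [nicholsAct_toNichols, one_smul]
  mul_smul g h b := by
    obtain ⟨a, rfl⟩ := toNichols_surjective D b
    change nicholsAct D (g * h) (toNichols D a) = nicholsAct D g (nicholsAct D h (toNichols D a))
    rw [nicholsAct_toNichols, nicholsAct_toNichols, nicholsAct_toNichols, mul_smul]
  smul_zero g := map_zero (nicholsAct D g)
  smul_add g := map_add (nicholsAct D g)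
  smul_one g := map_one (nicholsAct D g)
  smul_mul g := map_mul (nicholsAct D g)

theorem smul_toNichols (D : DiagonalYD k Γ ι) (g : Γ) (t : TV D) :
    g • toNichols D t = toNichols D (g • t) := nicholsAct_toNichols D g t

instance (D : DiagonalYD k Γ ι) : SMulCommClass Γ k (Nichols D) where
  smul_comm g c b := by
    obtain ⟨a, rfl⟩ := toNichols_surjective D b
    rw [← map_smul, smul_toNichols, smul_toNichols, ← map_smul, smul_comm]

/-- A quotient of the braided Hopf algebra `T(V)` in Yetter-Drinfeld modules. -/
class BraidedQuotient (D : DiagonalYD k Γ ι) (R : Type*) [Ring R] [Algebra k R]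
    [MulSemiringAction Γ R] [SMulCommClass Γ k R] where
  proj : TV D →ₐ[k] R
  surj : Function.Surjective proj
  smul_proj : ∀ (g : Γ) (t : TV D), g • proj t = proj (g • t)
  counit_ker : ∀ t, proj t = 0 → tcounit D t = 0
  coact_ker : ∀ t, proj t = 0 →
    Algebra.TensorProduct.map (AlgHom.id k (MonoidAlgebra k Γ)) proj (coact D t) = 0
  comul_ker : ∀ t, proj t = 0 →
    TensorProduct.map proj.toLinearMap proj.toLinearMap (braidedComul D t) = 0

open BraidedQuotient (proj)

instance (D : DiagonalYD k Γ ι) : BraidedQuotient D (TV D) where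
  proj := AlgHom.id k _
  surj := Function.surjective_id
  smul_proj _ _ := rfl
  counit_ker t ht := by rw [show t = 0 from ht, map_zero]
  coact_ker t ht := by rw [show t = 0 from ht, map_zero, map_zero]
  comul_ker t ht := by rw [show t = 0 from ht, map_zero, map_zero]

instance (D : DiagonalYD k Γ ι) : BraidedQuotient D (Nichols D) where
  proj := toNichols D
  surj := toNichols_surjective D
  smul_proj := smul_toNichols D
  counit_ker t ht := by
    have hI := nicholsIdeal_isNicholsCandidate D
    have h1 := hI.graded ((toNichols_eq_zero D).1 ht)
    have h2 : (⨆ n : ℕ, ⨆ _ : 2 ≤ n, (nicholsIdeal D).restrictScalars k ⊓ homog D n) ≤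
        LinearMap.ker (tcounit D).toLinearMap :=
      iSup_le fun n => iSup_le fun hn => fun x hx => homog_tcounit D (by omega) hx.2
    exact h2 h1
  coact_ker t ht := by
    have hI := nicholsIdeal_isNicholsCandidate D
    have h1 := hI.coact_mem t ((toNichols_eq_zero D).1 ht)
    have h2 : Submodule.map₂ (TensorProduct.mk k (MonoidAlgebra k Γ) (TV D)) ⊤
        ((nicholsIdeal D).restrictScalars k) ≤ LinearMap.ker
          (TensorProduct.map (LinearMap.id : MonoidAlgebra k Γ →ₗ[k] _)
            (toNichols D).toLinearMap) := by
      rw [Submodule.map₂_le]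
      intro a _ x hx
      have : toNichols D x = 0 := (toNichols_eq_zero D).2 hx
      simp [this]
    exact h2 h1
  comul_ker t ht := by
    have hI := nicholsIdeal_isNicholsCandidate D
    have h1 := hI.coideal t ((toNichols_eq_zero D).1 ht)
    have h2 : Submodule.map₂ (TensorProduct.mk k (TV D) (TV D))
          ((nicholsIdeal D).restrictScalars k) ⊤ ⊔
        Submodule.map₂ (TensorProduct.mk k (TV D) (TV D)) ⊤
          ((nicholsIdeal D).restrictScalars k) ≤ LinearMap.ker
          (TensorProduct.map (toNichols D).toLinearMap (toNichols D).toLinearMap) := by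
      refine sup_le ?_ ?_
      · rw [Submodule.map₂_le]
        intro x hx a _
        have : toNichols D x = 0 := (toNichols_eq_zero D).2 hx
        simp [this]
      · rw [Submodule.map₂_le]
        intro a _ x hx
        have : toNichols D x = 0 := (toNichols_eq_zero D).2 hx
        simp [this]
    exact h2 h1

/-- The underlying algebra of the bosonization `R # k[Γ]` of a quotient `R` of `T(V)`:
the smash product, with basis elements `r # g` and `(r # g) (s # h) = r (g • s) # g h`. -/
def Boson (D : DiagonalYD k Γ ι) (R : Type*) [Ring R] [Algebra k R]
    [MulSemiringAction Γ R] [SMulCommClass Γ k R] [BraidedQuotient D R] : Type _ :=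
  SkewMonoidAlgebra R Γ

namespace Boson

variable (D : DiagonalYD k Γ ι) (R : Type*) [Ring R] [Algebra k R]
    [MulSemiringAction Γ R] [SMulCommClass Γ k R] [BraidedQuotient D R]

instance : Ring (Boson D R) := inferInstanceAs (Ring (SkewMonoidAlgebra R Γ))

instance : Algebra k (Boson D R) := inferInstanceAs (Algebra k (SkewMonoidAlgebra R Γ))

/-- The inclusion `r ↦ r # 1`. -/
def inR : R →ₐ[k] Boson D R where
  __ := (SkewMonoidAlgebra.singleOneRingHom : R →+* SkewMonoidAlgebra R Γ)
  commutes' _ := rfl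

/-- The inclusion `g ↦ 1 # g`. -/
def inG : Γ →* Boson D R := SkewMonoidAlgebra.of R Γ

/-- The image of the basis element `E i` of `V` in the bosonization. -/
def bE (i : ι) : Boson D R := inR D R (proj (E D i))

variable {D R}

theorem inG_mul_inR (g : Γ) (r : R) : inG D R g * inR D R r = inR D R (g • r) * inG D R g := by
  have : (SkewMonoidAlgebra.single g 1 * SkewMonoidAlgebra.single 1 r : SkewMonoidAlgebra R Γ) =
      SkewMonoidAlgebra.single 1 (g • r) * SkewMonoidAlgebra.single g 1 := by
    simp [SkewMonoidAlgebra.single_mul_single]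
  exact this

theorem inG_mul_bE (g : Γ) (i : ι) :
    inG D R g * bE D R i = (D.char i g : k) • (bE D R i * inG D R g) := by
  rw [bE, inG_mul_inR, BraidedQuotient.smul_proj, smul_E, map_smul, map_smul, smul_mul_assoc]

theorem mem_of_inR_mul_inG {M : Submodule k (Boson D R)}
    (h : ∀ r g, inR D R r * inG D R g ∈ M) (x : Boson D R) : x ∈ M := by
  refine SkewMonoidAlgebra.induction_on (p := fun x => (show Boson D R from x) ∈ M)
    x M.zero_mem (fun g r => ?_) (fun _ _ hf hg => M.add_mem hf hg)
  have : (SkewMonoidAlgebra.single g r : SkewMonoidAlgebra R Γ) =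
      SkewMonoidAlgebra.single 1 r * SkewMonoidAlgebra.single g 1 := by
    simp [SkewMonoidAlgebra.single_mul_single]
  exact this ▸ h r g

/-- The universal property of the smash product. -/
def lift {A : Type*} [Ring A] [Algebra k A] (f : R →ₐ[k] A) (u : Γ →* A)
    (h : ∀ g r, f (g • r) * u g = u g * f r) : Boson D R →ₐ[k] A :=
  SkewMonoidAlgebra.liftNCAlgHom f u fun {x y} => h y x

@[simp] theorem lift_inR {A : Type*} [Ring A] [Algebra k A] (f : R →ₐ[k] A) (u : Γ →* A)
    (h : ∀ g r, f (g • r) * u g = u g * f r) (r : R) : lift (D := D) f u h (inR D R r) = f r := by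
  have : lift (D := D) f u h (inR D R r) = f r * u 1 :=
    SkewMonoidAlgebra.liftNC_single (f : R →+ A) u 1 r
  rw [this, map_one, mul_one]

@[simp] theorem lift_inG {A : Type*} [Ring A] [Algebra k A] (f : R →ₐ[k] A) (u : Γ →* A)
    (h : ∀ g r, f (g • r) * u g = u g * f r) (g : Γ) : lift (D := D) f u h (inG D R g) = u g := by
  have : lift (D := D) f u h (inG D R g) = f 1 * u g :=
    SkewMonoidAlgebra.liftNC_single (f : R →+ A) u g 1
  rw [this, map_one, one_mul]

theorem mem_of_gen {M : Submodule k (Boson D R)} (h1 : (1 : Boson D R) ∈ M)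
    (hG : ∀ g, ∀ t ∈ M, inG D R g * t ∈ M) (hE : ∀ i, ∀ t ∈ M, bE D R i * t ∈ M)
    (x : Boson D R) : x ∈ M := by
  refine mem_of_inR_mul_inG (fun r g => ?_) x
  obtain ⟨t, rfl⟩ := BraidedQuotient.surj (D := D) r
  have := TV_mem (D := D) (M := M.comap ((LinearMap.mulRight k (inG D R g)) ∘ₗ
    (inR D R).toLinearMap ∘ₗ (proj (D := D) (R := R)).toLinearMap)) ?_ ?_ t
  · exact this
  · have := hG g 1 h1
    simpa using this
  · intro i s hs
    have := hE i _ hs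
    simpa [bE, mul_assoc] using this

theorem algHom_ext {A : Type*} [Ring A] [Algebra k A] {f f' : Boson D R →ₐ[k] A}
    (hE : ∀ i, f (bE D R i) = f' (bE D R i)) (hG : ∀ g, f (inG D R g) = f' (inG D R g)) :
    f = f' := by
  ext x
  refine mem_of_gen (M := LinearMap.eqLocus f.toLinearMap f'.toLinearMap) ?_ ?_ ?_ x
  · simp [LinearMap.mem_eqLocus]
  · intro g t ht
    have ht : f t = f' t := ht
    simp [LinearMap.mem_eqLocus, ht, hG]
  · intro g t ht
    have ht : f t = f' t := ht
    simp [LinearMap.mem_eqLocus, ht, hE]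

/-! ### The coproduct -/

variable (D R)

theorem coact_comp_ker (t : TV D) (ht : proj (D := D) (R := R) t = 0) :
    ((Algebra.TensorProduct.map (AlgHom.id k (MonoidAlgebra k Γ)) (proj (D := D) (R := R))).comp
      (coact D)) t = 0 := by
  rw [AlgHom.comp_apply]
  exact BraidedQuotient.coact_ker t ht

/-- The coaction of `R`. -/
def coactR : R →ₐ[k] MonoidAlgebra k Γ ⊗[k] R :=
  descend (proj (D := D)) BraidedQuotient.surj
    ((Algebra.TensorProduct.map (AlgHom.id k _) (proj (D := D) (R := R))).comp (coact D))
    (coact_comp_ker D R)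

theorem coactR_proj_E (i : ι) : coactR D R (proj (E D i)) =
    MonoidAlgebra.of k Γ (D.grp i) ⊗ₜ proj (E D i) := by
  rw [coactR, descend_apply]
  simp [coact]

/-- The inclusion of the group algebra. -/
def inKG : MonoidAlgebra k Γ →ₐ[k] Boson D R := MonoidAlgebra.lift k (Boson D R) Γ (inG D R)

@[simp] theorem inKG_of (g : Γ) : inKG D R (MonoidAlgebra.of k Γ g) = inG D R g := by
  simp [inKG]

/-- `r ↦ r₍₋₁₎ ⊗ r₍₀₎`, inside the tensor square of the bosonization. -/
def coactB : R →ₐ[k] Boson D R ⊗[k] Boson D R :=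
  (Algebra.TensorProduct.map (inKG D R) (inR D R)).comp (coactR D R)

theorem coactB_proj_E (i : ι) : coactB D R (proj (E D i)) = inG D R (D.grp i) ⊗ₜ bE D R i := by
  rw [coactB, AlgHom.comp_apply, coactR_proj_E, Algebra.TensorProduct.map_tmul, inKG_of, bE]

/-- `r ⊗ s ↦ r s₍₋₁₎ ⊗ s₍₀₎`. -/
def kappa : R ⊗[k] R →ₗ[k] Boson D R ⊗[k] Boson D R :=
  LinearMap.mul' k _ ∘ₗ TensorProduct.map
    ((TensorProduct.mk k (Boson D R) (Boson D R)).flip 1 ∘ₗ (inR D R).toLinearMap)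
    (coactB D R).toLinearMap

theorem kappa_tmul (r s : R) : kappa D R (r ⊗ₜ s) = (inR D R r ⊗ₜ 1) * coactB D R s := by
  simp [kappa]

/-- The coproduct on `T(V)`, with values in the tensor square of the bosonization. -/
def comulT : TV D →ₐ[k] Boson D R ⊗[k] Boson D R :=
  liftE D fun i => bE D R i ⊗ₜ 1 + inG D R (D.grp i) ⊗ₜ bE D R i

theorem comulT_eq (t : TV D) : comulT D R t = kappa D R
    (TensorProduct.map (proj (D := D)).toLinearMap (proj (D := D)).toLinearMap
      (braidedComul D t)) := by
  refine TV_mem (D := D) (M := LinearMap.eqLocus (comulT D R).toLinearMap (kappa D R ∘ₗ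
    TensorProduct.map (proj (D := D)).toLinearMap (proj (D := D)).toLinearMap ∘ₗ
      braidedComul D)) ?_ ?_ t
  · rw [LinearMap.mem_eqLocus]
    simp [braidedComul_one, kappa_tmul, Algebra.TensorProduct.one_def]
  · intro i s hs
    rw [LinearMap.mem_eqLocus] at hs ⊢
    simp only [LinearMap.comp_apply, AlgHom.toLinearMap_apply] at hs ⊢
    rw [map_mul, hs, braidedComul_E_mul]
    generalize braidedComul D s = z
    induction z with
    | zero => simp
    | add a b ha hb => simp only [map_add, mul_add, ha, hb]
    | tmul x y =>
      simp only [braidedMulLeft_tmul, map_add, TensorProduct.map_tmul, kappa_tmul,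
        AlgHom.toLinearMap_apply, map_mul, coactB_proj_E, comulT, liftE_E]
      rw [add_mul, ← mul_assoc, ← mul_assoc, ← mul_assoc, ← BraidedQuotient.smul_proj]
      simp only [Algebra.TensorProduct.tmul_mul_tmul, one_mul, mul_one, inG_mul_inR, bE]

/-- The coproduct on `R`. -/
def comulR : R →ₐ[k] Boson D R ⊗[k] Boson D R :=
  descend (proj (D := D)) BraidedQuotient.surj (comulT D R) fun t ht => by
    rw [comulT_eq, BraidedQuotient.comul_ker t ht, map_zero]

theorem comulR_proj (t : TV D) : comulR D R (proj t) = comulT D R t := descend_apply ..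

theorem comulT_smul (g : Γ) (t : TV D) :
    comulT D R (g • t) * (inG D R g ⊗ₜ inG D R g) = (inG D R g ⊗ₜ inG D R g) * comulT D R t := by
  refine TV_mem (D := D) (M := LinearMap.eqLocus
    (LinearMap.mulRight k (inG D R g ⊗ₜ inG D R g) ∘ₗ (comulT D R).toLinearMap ∘ₗ
      (act D g).toLinearMap)
    (LinearMap.mulLeft k (inG D R g ⊗ₜ inG D R g) ∘ₗ (comulT D R).toLinearMap)) ?_ ?_ t
  · simp [LinearMap.mem_eqLocus]
  · intro i s hs
    have hs : comulT D R (g • s) * (inG D R g ⊗ₜ inG D R g) =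
      (inG D R g ⊗ₜ inG D R g) * comulT D R s := hs
    change comulT D R (g • (E D i * s)) * (inG D R g ⊗ₜ inG D R g) =
      (inG D R g ⊗ₜ inG D R g) * comulT D R (E D i * s)
    rw [smul_mul', map_mul, mul_assoc, hs, map_mul, ← mul_assoc, ← mul_assoc]
    congr 1
    rw [smul_E, map_smul, comulT, liftE_E, mul_add, smul_mul_assoc, add_mul]
    simp only [Algebra.TensorProduct.tmul_mul_tmul, one_mul, mul_one, inG_mul_bE, ← map_mul,
      TensorProduct.tmul_smul, TensorProduct.smul_tmul', smul_add, mul_comm g]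

/-- The group-like coproduct of `Γ`. -/
def comulG : Γ →* Boson D R ⊗[k] Boson D R where
  toFun g := inG D R g ⊗ₜ inG D R g
  map_one' := by simp [Algebra.TensorProduct.one_def]
  map_mul' := by simp

/-- The coproduct of the bosonization: `g ↦ g ⊗ g` and `E i ↦ E i ⊗ 1 + grp i ⊗ E i`. -/
def comulB : Boson D R →ₐ[k] Boson D R ⊗[k] Boson D R :=
  lift (comulR D R) (comulG D R) fun g r => by
    obtain ⟨t, rfl⟩ := BraidedQuotient.surj (D := D) r
    rw [BraidedQuotient.smul_proj, comulR_proj, comulR_proj]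
    exact comulT_smul D R g t

/-- The counit of the bosonization: `g ↦ 1` and `E i ↦ 0`. -/
def counitB : Boson D R →ₐ[k] k :=
  lift (descend (proj (D := D)) BraidedQuotient.surj (tcounit D) BraidedQuotient.counit_ker) 1
    fun g r => by
      obtain ⟨t, rfl⟩ := BraidedQuotient.surj (D := D) r
      rw [BraidedQuotient.smul_proj, descend_apply, descend_apply, MonoidHom.one_apply, mul_one,
        one_mul]
      have : (tcounit D).comp (act D g) = tcounit D := TV_hom_ext fun i => by
        simp [act, tcounit]
      exact congrArg (fun f => f t) this

@[simp] theorem comulB_inG (g : Γ) : comulB D R (inG D R g) = inG D R g ⊗ₜ inG D R g := by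
  rw [comulB, lift_inG]
  rfl

@[simp] theorem comulB_bE (i : ι) : comulB D R (bE D R i) =
    bE D R i ⊗ₜ 1 + inG D R (D.grp i) ⊗ₜ bE D R i := by
  rw [bE, comulB, lift_inR, comulR_proj, comulT, liftE_E, bE]

@[simp] theorem counitB_inG (g : Γ) : counitB D R (inG D R g) = 1 := by
  simp [counitB]

@[simp] theorem counitB_bE (i : ι) : counitB D R (bE D R i) = 0 := by
  rw [bE, counitB, lift_inR, descend_apply, tcounit, liftE_E]

instance : Bialgebra k (Boson D R) :=
  Bialgebra.ofAlgHom (comulB D R) (counitB D R)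
    (algHom_ext (fun i => by
        simp [TensorProduct.add_tmul, TensorProduct.tmul_add, Algebra.TensorProduct.one_def,
          add_assoc]) (fun g => by simp))
    (algHom_ext (fun i => by simp) (fun g => by simp))
    (algHom_ext (fun i => by simp) (fun g => by simp))

@[simp] theorem comul_inG (g : Γ) :
    Coalgebra.comul (R := k) (inG D R g) = inG D R g ⊗ₜ[k] inG D R g := comulB_inG D R g

@[simp] theorem comul_bE (i : ι) : Coalgebra.comul (R := k) (bE D R i) =
    bE D R i ⊗ₜ[k] 1 + inG D R (D.grp i) ⊗ₜ[k] bE D R i := comulB_bE D R i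

@[simp] theorem counit_inG (g : Γ) : Coalgebra.counit (R := k) (inG D R g) = 1 := counitB_inG D R g

@[simp] theorem counit_bE (i : ι) : Coalgebra.counit (R := k) (bE D R i) = 0 := counitB_bE D R i

end Boson

namespace Boson

/-! ### The antipode -/

variable (D : DiagonalYD k Γ ι) (R : Type*) [Ring R] [Algebra k R]
    [MulSemiringAction Γ R] [SMulCommClass Γ k R] [BraidedQuotient D R]

variable {R} in
/-- The span of the words of length at most `n` in `T(V)`. -/
def fil : ℕ → Submodule k (TV D)
  | 0 => 1
  | n + 1 => fil n ⊔ ⨆ i, (fil n).map (LinearMap.mulLeft k (E D i))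

theorem fil_le_succ (n : ℕ) : fil D n ≤ fil D (n + 1) := le_sup_left

theorem fil_mono {m n : ℕ} (h : m ≤ n) : fil D m ≤ fil D n := monotone_nat_of_le_succ (fil_le_succ D) h

theorem one_mem_fil (n : ℕ) : (1 : TV D) ∈ fil D n :=
  fil_mono D (Nat.zero_le n) (Submodule.one_le.1 le_rfl)

theorem E_mul_mem_fil {n : ℕ} (i : ι) {t : TV D} (ht : t ∈ fil D n) : E D i * t ∈ fil D (n + 1) :=
  (le_sup_right : _ ≤ fil D (n + 1)) (Submodule.mem_iSup_of_mem i ⟨t, ht, rfl⟩)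

theorem fil_succ_induction {n : ℕ} {M : Submodule k (TV D)} (h : fil D n ≤ M)
    (hE : ∀ i, ∀ t ∈ fil D n, E D i * t ∈ M) : fil D (n + 1) ≤ M := by
  refine sup_le h (iSup_le fun i => ?_)
  rintro _ ⟨t, ht, rfl⟩
  exact hE i t ht

theorem exists_mem_fil (t : TV D) : ∃ n, t ∈ fil D n := by
  have h : ∀ t : TV D, t ∈ ⨆ n, fil D n := by
    intro t
    refine TV_mem (D := D) (M := ⨆ n, fil D n) (Submodule.mem_iSup_of_mem 0 (one_mem_fil D 0)) ?_ t
    intro i s hs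
    rw [Submodule.mem_iSup_of_directed _ (monotone_nat_of_le_succ (fil_le_succ D)).directed_le] at hs
    obtain ⟨n, hn⟩ := hs
    exact Submodule.mem_iSup_of_mem (n + 1) (E_mul_mem_fil D i hn)
  have := h t
  rwa [Submodule.mem_iSup_of_directed _ (monotone_nat_of_le_succ (fil_le_succ D)).directed_le] at this

theorem smul_mem_fil {n : ℕ} (g : Γ) {t : TV D} (ht : t ∈ fil D n) : g • t ∈ fil D n := by
  induction n generalizing t with
  | zero =>
    obtain ⟨c, rfl⟩ := Submodule.mem_one.1 ht
    rw [act_def, (act D g).commutes]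
    exact ht
  | succ n ih =>
    refine fil_succ_induction D (M := (fil D (n + 1)).comap (act D g).toLinearMap) ?_ ?_ ht
    · intro s hs
      exact fil_le_succ D n (ih hs)
    · intro i s hs
      change g • (E D i * s) ∈ fil D (n + 1)
      rw [smul_mul', smul_E, smul_mul_assoc]
      exact Submodule.smul_mem _ _ (E_mul_mem_fil D i (ih hs))

theorem braidedMulLeft_mem {n : ℕ} (i : ι) {z : TV D ⊗[k] TV D}
    (hz : z ∈ Submodule.map₂ (TensorProduct.mk k (TV D) (TV D)) (fil D n) ⊤) :
    braidedMulLeft D i z ∈ Submodule.map₂ (TensorProduct.mk k (TV D) (TV D)) (fil D (n + 1)) ⊤ := by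
  have : Submodule.map₂ (TensorProduct.mk k (TV D) (TV D)) (fil D n) ⊤ ≤
      (Submodule.map₂ (TensorProduct.mk k (TV D) (TV D)) (fil D (n + 1)) ⊤).comap
        (braidedMulLeft D i) := by
    rw [Submodule.map₂_le]
    intro x hx y _
    rw [Submodule.mem_comap, TensorProduct.mk_apply, braidedMulLeft_tmul]
    exact add_mem (Submodule.apply_mem_map₂ _ (E_mul_mem_fil D i hx) trivial)
      (Submodule.apply_mem_map₂ _ (fil_le_succ D n (smul_mem_fil D _ hx)) trivial)
  exact this hz

theorem braidedComul_sub_mem {n : ℕ} {t : TV D} (ht : t ∈ fil D (n + 1)) :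
    braidedComul D t - t ⊗ₜ 1 ∈
      Submodule.map₂ (TensorProduct.mk k (TV D) (TV D)) (fil D n) ⊤ := by
  let L : TV D →ₗ[k] TV D ⊗[k] TV D := braidedComul D - (TensorProduct.mk k (TV D) (TV D)).flip 1
  have hE : ∀ i s, L (E D i * s) = braidedMulLeft D i (L s) + (D.grp i • s) ⊗ₜ E D i := by
    intro i s
    simp only [L, LinearMap.sub_apply, LinearMap.flip_apply, TensorProduct.mk_apply, map_sub,
      braidedComul_E_mul, braidedMulLeft_tmul, mul_one]
    abel
  have h0 : fil D 0 ≤ LinearMap.ker L := by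
    refine Submodule.one_le.2 ?_
    simp [L, braidedComul_one]
  change L t ∈ _
  induction n generalizing t with
  | zero =>
    refine fil_succ_induction D (M := (Submodule.map₂ (TensorProduct.mk k (TV D) (TV D))
      (fil D 0) ⊤).comap L) ?_ ?_ ht
    · intro s hs
      rw [Submodule.mem_comap, h0 hs]
      exact zero_mem _
    · intro i s hs
      rw [Submodule.mem_comap, hE, h0 hs, map_zero, zero_add]
      exact Submodule.apply_mem_map₂ _ (smul_mem_fil D _ hs) trivial
  | succ n ih =>
    refine fil_succ_induction D (M := (Submodule.map₂ (TensorProduct.mk k (TV D) (TV D))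
      (fil D (n + 1)) ⊤).comap L) ?_ ?_ ht
    · intro s hs
      exact Submodule.map₂_le_map₂_left (fil_le_succ D n) (ih hs)
    · intro i s hs
      rw [Submodule.mem_comap, hE]
      exact add_mem (braidedMulLeft_mem D i (ih hs))
        (Submodule.apply_mem_map₂ _ (smul_mem_fil D _ hs) trivial)

variable {D R}

/-- A linear map that is a one-sided convolution inverse of the projection factors through it. -/
theorem vanish_of_convolution {H : Type*} [AddCommGroup H] [Module k H] (F : TV D →ₗ[k] H)
    (M : H ⊗[k] R →ₗ[k] H) (e : H) (hM : ∀ h, M (h ⊗ₜ 1) = h)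
    (hF : ∀ t, M (TensorProduct.map F (proj (D := D)).toLinearMap (braidedComul D t)) =
      tcounit D t • e) (t : TV D) (ht : proj (D := D) (R := R) t = 0) : F t = 0 := by
  obtain ⟨n, hn⟩ := exists_mem_fil D t
  induction n generalizing t with
  | zero =>
    obtain ⟨c, rfl⟩ := Submodule.mem_one.1 hn
    have := BraidedQuotient.counit_ker _ ht
    rw [(tcounit D).commutes, Algebra.algebraMap_self_apply] at this
    rw [this, map_zero, map_zero]
  | succ n ih =>
    set p : TV D →ₗ[k] R := (proj (D := D) (R := R)).toLinearMap with hp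
    obtain ⟨G, hG⟩ : ∃ G : R →ₗ[k] H, ∀ s ∈ fil D n, F s = G (p s) := by
      let q : fil D n →ₗ[k] R := p ∘ₗ (fil D n).subtype
      have hker : LinearMap.ker q ≤ LinearMap.ker (F ∘ₗ (fil D n).subtype) := by
        intro s hs
        exact ih s hs s.2
      obtain ⟨G, hG⟩ := LinearMap.exists_extend
        ((LinearMap.ker q).liftQ _ hker ∘ₗ q.quotKerEquivRange.symm.toLinearMap)
      refine ⟨G, fun s hs => ?_⟩
      have h1 := congrArg (fun f => f (q.quotKerEquivRange (Submodule.Quotient.mk ⟨s, hs⟩))) hG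
      simp only [LinearMap.comp_apply, LinearEquiv.coe_coe, LinearEquiv.symm_apply_apply,
        Submodule.liftQ_apply] at h1
      exact h1.symm
    have hz := braidedComul_sub_mem D hn
    set z := braidedComul D t - t ⊗ₜ 1 with hzdef
    have h1 : TensorProduct.map F p z =
        TensorProduct.map G LinearMap.id (TensorProduct.map p p z) := by
      have : Submodule.map₂ (TensorProduct.mk k (TV D) (TV D)) (fil D n) ⊤ ≤
          LinearMap.eqLocus (TensorProduct.map F p)
            (TensorProduct.map G LinearMap.id ∘ₗ TensorProduct.map p p) := by
        rw [Submodule.map₂_le]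
        intro x hx y _
        simp [LinearMap.mem_eqLocus, hG x hx]
      exact this hz
    have hpt : p t = 0 := ht
    have h2 : TensorProduct.map p p z = 0 := by
      rw [hzdef, map_sub, BraidedQuotient.comul_ker t ht, TensorProduct.map_tmul, hpt,
        TensorProduct.zero_tmul, sub_zero]
    have h3 : braidedComul D t = z + t ⊗ₜ 1 := by rw [hzdef, sub_add_cancel]
    have h4 := hF t
    rw [BraidedQuotient.counit_ker t ht, zero_smul, h3, map_add, h1, h2, map_zero, zero_add,
      TensorProduct.map_tmul] at h4
    have h5 : p 1 = 1 := map_one (proj (D := D) (R := R))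
    rwa [h5, hM] at h4

open MulOpposite

variable (D R)

/-- The antipode on the elements of `Γ`. -/
def antiG : Γ →* (Boson D R)ᵐᵒᵖ where
  toFun g := op (inG D R g⁻¹)
  map_one' := by simp
  map_mul' g h := by rw [← op_mul, ← map_mul, mul_inv_rev]

theorem inG_mul_inv (g : Γ) : inG D R g * inG D R g⁻¹ = 1 := by rw [← map_mul]; simp

theorem inG_inv_mul (g : Γ) : inG D R g⁻¹ * inG D R g = 1 := by rw [← map_mul]; simp

theorem bE_mul_inG (g : Γ) (i : ι) :
    bE D R i * inG D R g = (D.char i g⁻¹ : k) • (inG D R g * bE D R i) := by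
  rw [inG_mul_bE, smul_smul, ← Units.val_mul, ← map_mul]
  simp

/-- The anti-algebra maps on `T(V)` with values `E i ↦ x i` where `x i` is `-grp i⁻¹ * E i`
(for the antipode) or `-E i * grp i⁻¹` (for its inverse). -/
theorem anti_smul (x : ι → Boson D R)
    (hx : ∀ g i, inG D R g * x i = (D.char i g : k) • (x i * inG D R g)) (g : Γ) (t : TV D) :
    (liftE D fun i => op (x i)) (g • t) * op (inG D R g⁻¹) =
      op (inG D R g⁻¹) * (liftE D fun i => op (x i)) t := by
  refine TV_mem (D := D) (M := LinearMap.eqLocus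
    (LinearMap.mulRight k (op (inG D R g⁻¹)) ∘ₗ (liftE D fun i => op (x i)).toLinearMap ∘ₗ
      (act D g).toLinearMap)
    (LinearMap.mulLeft k (op (inG D R g⁻¹)) ∘ₗ (liftE D fun i => op (x i)).toLinearMap)) ?_ ?_ t
  · simp [LinearMap.mem_eqLocus]
  · intro i s hs
    set F := liftE D fun i => op (x i) with hF
    have hs : F (g • s) * op (inG D R g⁻¹) = op (inG D R g⁻¹) * F s := hs
    change F (g • (E D i * s)) * op (inG D R g⁻¹) = op (inG D R g⁻¹) * F (E D i * s)
    rw [smul_mul', map_mul, mul_assoc, hs, map_mul, ← mul_assoc, ← mul_assoc]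
    congr 1
    rw [smul_E, map_smul, hF, liftE_E, smul_mul_assoc, ← op_mul, ← op_mul, ← op_smul, hx,
      smul_smul, ← Units.val_mul, ← map_mul]
    simp

/-- Inversion on the group algebra, with values in the bosonization. -/
def invG : MonoidAlgebra k Γ →ₐ[k] Boson D R :=
  MonoidAlgebra.lift k (Boson D R) Γ ((inG D R).comp (invMonoidHom))

@[simp] theorem invG_of (g : Γ) : invG D R (MonoidAlgebra.of k Γ g) = inG D R g⁻¹ := by
  simp [invG]

theorem invG_comm (a b : MonoidAlgebra k Γ) : invG D R a * invG D R b = invG D R b * invG D R a := by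
  rw [← map_mul, mul_comm, map_mul]

/-- The operators `h ↦ a⁻¹ h r`. -/
def opS : MonoidAlgebra k Γ ⊗[k] R →ₗ[k] Module.End k (Boson D R) :=
  TensorProduct.lift <| LinearMap.mk₂ k
    (fun a r => LinearMap.mulLeft k (invG D R a) ∘ₗ LinearMap.mulRight k (inR D R r))
    (fun a b r => by ext; simp [add_mul]) (fun c a r => by ext; simp)
    (fun a r s => by ext; simp [mul_add]) (fun c a r => by ext; simp)

/-- The operators `h ↦ r a⁻¹ h`. -/
def opS' : MonoidAlgebra k Γ ⊗[k] R →ₗ[k] Module.End k (Boson D R) :=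
  TensorProduct.lift <| LinearMap.mk₂ k
    (fun a r => LinearMap.mulLeft k (inR D R r) ∘ₗ LinearMap.mulLeft k (invG D R a))
    (fun a b r => by ext; simp [add_mul, mul_add]) (fun c a r => by ext; simp)
    (fun a r s => by ext; simp [add_mul]) (fun c a r => by ext; simp)

theorem opS_mul (i : ι) (g : Γ) (w : MonoidAlgebra k Γ ⊗[k] R) (h : Boson D R) :
    opS D R ((MonoidAlgebra.of k Γ g ⊗ₜ proj (E D i)) * w) h =
      opS D R w (inG D R g⁻¹ * h * bE D R i) := by
  induction w with
  | zero => simp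
  | add a b ha hb => simp only [mul_add, map_add, LinearMap.add_apply, ha, hb]
  | tmul a r =>
    rw [Algebra.TensorProduct.tmul_mul_tmul, mul_comm]
    simp only [opS, TensorProduct.lift.tmul, LinearMap.mk₂_apply, LinearMap.comp_apply,
      LinearMap.mulLeft_apply, LinearMap.mulRight_apply, map_mul, invG_of, bE, mul_assoc]

theorem opS'_mul (i : ι) (g : Γ) (w : MonoidAlgebra k Γ ⊗[k] R) (h : Boson D R) :
    opS' D R ((MonoidAlgebra.of k Γ g ⊗ₜ proj (E D i)) * w) h =
      bE D R i * opS' D R w (inG D R g⁻¹ * h) := by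
  induction w with
  | zero => simp
  | add a b ha hb => simp only [mul_add, map_add, LinearMap.add_apply, ha, hb]
  | tmul a r =>
    rw [Algebra.TensorProduct.tmul_mul_tmul, mul_comm]
    simp only [opS', TensorProduct.lift.tmul, LinearMap.mk₂_apply, LinearMap.comp_apply,
      LinearMap.mulLeft_apply, map_mul, invG_of, bE, mul_assoc]

theorem opS'_mul_right (w : MonoidAlgebra k Γ ⊗[k] R) (h h' : Boson D R) :
    opS' D R w (h * h') = opS' D R w h * h' := by
  induction w with
  | zero => simp
  | add a b ha hb => simp only [add_mul, map_add, LinearMap.add_apply, ha, hb]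
  | tmul a r => simp [opS', mul_assoc]

/-- `-grp i⁻¹ * E i`. -/
def xS (i : ι) : Boson D R := -(inG D R (D.grp i)⁻¹ * bE D R i)

/-- `-E i * grp i⁻¹`. -/
def xS' (i : ι) : Boson D R := -(bE D R i * inG D R (D.grp i)⁻¹)

theorem inG_mul_xS (g : Γ) (i : ι) :
    inG D R g * xS D R i = (D.char i g : k) • (xS D R i * inG D R g) := by
  rw [xS, mul_neg, neg_mul, smul_neg, ← mul_assoc, ← map_mul, mul_comm g, map_mul, mul_assoc,
    inG_mul_bE, mul_smul_comm, mul_assoc]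

theorem inG_mul_xS' (g : Γ) (i : ι) :
    inG D R g * xS' D R i = (D.char i g : k) • (xS' D R i * inG D R g) := by
  rw [xS', mul_neg, neg_mul, smul_neg, ← mul_assoc, inG_mul_bE, smul_mul_assoc, mul_assoc,
    mul_assoc, ← map_mul, mul_comm g, map_mul]

/-- The antipode on `T(V)`. -/
def antiT : TV D →ₐ[k] (Boson D R)ᵐᵒᵖ := liftE D fun i => op (xS D R i)

/-- The inverse antipode on `T(V)`. -/
def antiT' : TV D →ₐ[k] (Boson D R)ᵐᵒᵖ := liftE D fun i => op (xS' D R i)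

theorem unop_antiT_smul (g : Γ) (t : TV D) :
    inG D R g⁻¹ * unop (antiT D R (g • t)) = unop (antiT D R t) * inG D R g⁻¹ := by
  have := anti_smul D R (xS D R) (inG_mul_xS D R) g t
  exact congrArg unop this

theorem unop_antiT'_smul (g : Γ) (t : TV D) :
    inG D R g⁻¹ * unop (antiT' D R (g • t)) = unop (antiT' D R t) * inG D R g⁻¹ := by
  have := anti_smul D R (xS' D R) (inG_mul_xS' D R) g t
  exact congrArg unop this

theorem antiT_ker (t : TV D) (ht : proj (D := D) (R := R) t = 0) : antiT D R t = 0 := by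
  have key := vanish_of_convolution (D := D) (R := R)
    ((opLinearEquiv k).symm.toLinearMap ∘ₗ (antiT D R).toLinearMap)
    (TensorProduct.lift (LinearMap.flip (opS D R ∘ₗ (coactR D R).toLinearMap))) 1 ?_ ?_ t ht
  · exact unop_injective key
  · intro h
    simp [Algebra.TensorProduct.one_def, opS]
  · intro t
    refine TV_mem (D := D) (M := LinearMap.eqLocus
      (TensorProduct.lift (LinearMap.flip (opS D R ∘ₗ (coactR D R).toLinearMap)) ∘ₗ
        TensorProduct.map ((opLinearEquiv k).symm.toLinearMap ∘ₗ (antiT D R).toLinearMap)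
          (proj (D := D)).toLinearMap ∘ₗ braidedComul D)
      ((tcounit D).toLinearMap.smulRight 1)) ?_ ?_ t
    · simp [LinearMap.mem_eqLocus, braidedComul_one, Algebra.TensorProduct.one_def, opS]
    · intro i s _
      rw [LinearMap.mem_eqLocus]
      have h0 : tcounit D (E D i * s) = 0 := by simp [tcounit]
      simp only [LinearMap.comp_apply, LinearMap.smulRight_apply, AlgHom.toLinearMap_apply, h0,
        zero_smul, braidedComul_E_mul]
      generalize braidedComul D s = z
      induction z with
      | zero => simp
      | add a b ha hb => simp only [map_add, ha, hb, add_zero]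
      | tmul x y =>
        have h1 : unop (antiT D R (E D i)) = xS D R i := by simp [antiT]
        simp only [braidedMulLeft_tmul, map_add, TensorProduct.map_tmul, TensorProduct.lift.tmul,
          LinearMap.flip_apply, LinearMap.comp_apply, AlgHom.toLinearMap_apply, map_mul,
          LinearEquiv.coe_coe, coe_opLinearEquiv_symm, coactR_proj_E, opS_mul, unop_antiT_smul,
          unop_mul, h1, xS, mul_neg, map_neg, mul_assoc]
        exact neg_add_cancel _

theorem antiT'_ker (t : TV D) (ht : proj (D := D) (R := R) t = 0) : antiT' D R t = 0 := by
  have key := vanish_of_convolution (D := D) (R := R)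
    ((opLinearEquiv k).symm.toLinearMap ∘ₗ (antiT' D R).toLinearMap)
    (TensorProduct.lift (LinearMap.flip (opS' D R ∘ₗ (coactR D R).toLinearMap))) 1 ?_ ?_ t ht
  · exact unop_injective key
  · intro h
    simp [Algebra.TensorProduct.one_def, opS']
  · intro t
    refine TV_mem (D := D) (M := LinearMap.eqLocus
      (TensorProduct.lift (LinearMap.flip (opS' D R ∘ₗ (coactR D R).toLinearMap)) ∘ₗ
        TensorProduct.map ((opLinearEquiv k).symm.toLinearMap ∘ₗ (antiT' D R).toLinearMap)
          (proj (D := D)).toLinearMap ∘ₗ braidedComul D)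
      ((tcounit D).toLinearMap.smulRight 1)) ?_ ?_ t
    · simp [LinearMap.mem_eqLocus, braidedComul_one, Algebra.TensorProduct.one_def, opS']
    · intro i s hs
      rw [LinearMap.mem_eqLocus] at hs ⊢
      have h0 : tcounit D (E D i * s) = 0 := by simp [tcounit]
      simp only [LinearMap.comp_apply, LinearMap.smulRight_apply, AlgHom.toLinearMap_apply, h0,
        zero_smul, braidedComul_E_mul] at hs ⊢
      have hz : ∀ z : TV D ⊗[k] TV D,
          TensorProduct.lift (LinearMap.flip (opS' D R ∘ₗ (coactR D R).toLinearMap))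
            (TensorProduct.map ((opLinearEquiv k).symm.toLinearMap ∘ₗ (antiT' D R).toLinearMap)
              (proj (D := D)).toLinearMap (braidedMulLeft D i z)) =
          TensorProduct.lift (LinearMap.flip (opS' D R ∘ₗ (coactR D R).toLinearMap))
            (TensorProduct.map ((opLinearEquiv k).symm.toLinearMap ∘ₗ (antiT' D R).toLinearMap)
              (proj (D := D)).toLinearMap z) * xS' D R i +
          bE D R i * (TensorProduct.lift (LinearMap.flip (opS' D R ∘ₗ (coactR D R).toLinearMap))
            (TensorProduct.map ((opLinearEquiv k).symm.toLinearMap ∘ₗ (antiT' D R).toLinearMap)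
              (proj (D := D)).toLinearMap z) * inG D R (D.grp i)⁻¹) := by
        intro z
        induction z with
        | zero => simp
        | add a b ha hb =>
          simp only [map_add, ha, hb, add_mul, mul_add]
          abel
        | tmul x y =>
          have h1 : unop (antiT' D R (E D i)) = xS' D R i := by simp [antiT']
          simp only [braidedMulLeft_tmul, map_add, TensorProduct.map_tmul,
            TensorProduct.lift.tmul, LinearMap.flip_apply, LinearMap.comp_apply,
            AlgHom.toLinearMap_apply, map_mul, LinearEquiv.coe_coe, coe_opLinearEquiv_symm,
            coactR_proj_E, opS'_mul, unop_antiT'_smul, unop_mul, h1, opS'_mul_right]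
      rw [hz, hs, xS']
      simp

/-- The antipode of the bosonization, as an algebra map to the opposite algebra:
`g ↦ g⁻¹` and `E i ↦ -grp i⁻¹ * E i`. -/
def antiB : Boson D R →ₐ[k] (Boson D R)ᵐᵒᵖ :=
  lift (descend (proj (D := D)) BraidedQuotient.surj (antiT D R) (antiT_ker D R)) (antiG D R)
    fun g r => by
      obtain ⟨t, rfl⟩ := BraidedQuotient.surj (D := D) r
      rw [BraidedQuotient.smul_proj, descend_apply, descend_apply]
      exact anti_smul D R (xS D R) (inG_mul_xS D R) g t

/-- The inverse of the antipode of the bosonization, as an algebra map to the opposite algebra: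
`g ↦ g⁻¹` and `E i ↦ -E i * grp i⁻¹`. -/
def antiB' : Boson D R →ₐ[k] (Boson D R)ᵐᵒᵖ :=
  lift (descend (proj (D := D)) BraidedQuotient.surj (antiT' D R) (antiT'_ker D R)) (antiG D R)
    fun g r => by
      obtain ⟨t, rfl⟩ := BraidedQuotient.surj (D := D) r
      rw [BraidedQuotient.smul_proj, descend_apply, descend_apply]
      exact anti_smul D R (xS' D R) (inG_mul_xS' D R) g t

@[simp] theorem antiB_inG (g : Γ) : antiB D R (inG D R g) = op (inG D R g⁻¹) := by
  rw [antiB, lift_inG]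
  rfl

@[simp] theorem antiB'_inG (g : Γ) : antiB' D R (inG D R g) = op (inG D R g⁻¹) := by
  rw [antiB', lift_inG]
  rfl

@[simp] theorem antiB_bE (i : ι) : antiB D R (bE D R i) = op (xS D R i) := by
  rw [bE, antiB, lift_inR, descend_apply, antiT, liftE_E]

@[simp] theorem antiB'_bE (i : ι) : antiB' D R (bE D R i) = op (xS' D R i) := by
  rw [bE, antiB', lift_inR, descend_apply, antiT', liftE_E]

theorem antiB_antiB' (x : Boson D R) : unop (antiB D R (unop (antiB' D R x))) = x := by
  have : ((AlgHom.opComm (antiB D R)).comp (antiB' D R)) = AlgHom.id k _ := by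
    refine algHom_ext (fun i => ?_) (fun g => ?_)
    · simp [xS, xS', ← mul_assoc, inG_mul_inv]
    · simp
  exact congrArg (fun f => f x) this

theorem antiB'_antiB (x : Boson D R) : unop (antiB' D R (unop (antiB D R x))) = x := by
  have : ((AlgHom.opComm (antiB' D R)).comp (antiB D R)) = AlgHom.id k _ := by
    refine algHom_ext (fun i => ?_) (fun g => ?_)
    · simp [xS, xS', mul_assoc, inG_inv_mul]
    · simp
  exact congrArg (fun f => f x) this

/-- The antipode of the bosonization, as a linear map. -/
def antipodeB : Boson D R →ₗ[k] Boson D R :=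
  (opLinearEquiv k).symm.toLinearMap ∘ₗ (antiB D R).toLinearMap

theorem antipodeB_mul (a b : Boson D R) :
    antipodeB D R (a * b) = antipodeB D R b * antipodeB D R a := by
  simp [antipodeB]

@[simp] theorem antipodeB_one : antipodeB D R 1 = 1 := by simp [antipodeB]

@[simp] theorem antipodeB_inG (g : Γ) : antipodeB D R (inG D R g) = inG D R g⁻¹ := by
  simp [antipodeB]

@[simp] theorem antipodeB_bE (i : ι) : antipodeB D R (bE D R i) = xS D R i := by
  simp [antipodeB]

theorem antipodeB_bijective : Function.Bijective (antipodeB D R) :=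
  Function.bijective_iff_has_inverse.2
    ⟨fun x => unop (antiB' D R x), antiB'_antiB D R, antiB_antiB' D R⟩

theorem rTensor_mul (x y : Boson D R ⊗[k] Boson D R) (c : k)
    (hx : LinearMap.mul' k _ ((antipodeB D R).rTensor _ x) = c • 1) :
    LinearMap.mul' k _ ((antipodeB D R).rTensor _ (x * y)) =
      c • LinearMap.mul' k _ ((antipodeB D R).rTensor _ y) := by
  induction y with
  | zero => simp
  | add a b ha hb => simp only [mul_add, map_add, smul_add, ha, hb]
  | tmul a b =>
    have : ∀ x : Boson D R ⊗[k] Boson D R,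
        LinearMap.mul' k _ ((antipodeB D R).rTensor _ (x * a ⊗ₜ b)) =
        antipodeB D R a * LinearMap.mul' k _ ((antipodeB D R).rTensor _ x) * b := by
      intro x
      induction x with
      | zero => simp
      | add a b ha hb => simp only [add_mul, map_add, mul_add, ha, hb]
      | tmul u v => simp [antipodeB_mul, mul_assoc]
    rw [this, hx]
    simp

theorem lTensor_mul (x y : Boson D R ⊗[k] Boson D R) (c : k)
    (hy : LinearMap.mul' k _ ((antipodeB D R).lTensor _ y) = c • 1) :
    LinearMap.mul' k _ ((antipodeB D R).lTensor _ (x * y)) =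
      c • LinearMap.mul' k _ ((antipodeB D R).lTensor _ x) := by
  induction x with
  | zero => simp
  | add a b ha hb => simp only [add_mul, map_add, smul_add, ha, hb]
  | tmul a b =>
    have : ∀ y : Boson D R ⊗[k] Boson D R,
        LinearMap.mul' k _ ((antipodeB D R).lTensor _ (a ⊗ₜ b * y)) =
        a * LinearMap.mul' k _ ((antipodeB D R).lTensor _ y) * antipodeB D R b := by
      intro x
      induction x with
      | zero => simp
      | add a b ha hb => simp only [add_mul, map_add, mul_add, ha, hb]
      | tmul u v => simp [antipodeB_mul, mul_assoc]
    rw [this, hy]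
    simp

theorem antipodeB_left (x : Boson D R) :
    LinearMap.mul' k _ ((antipodeB D R).rTensor _ (comulB D R x)) = counitB D R x • 1 := by
  refine mem_of_gen (M := LinearMap.eqLocus (LinearMap.mul' k _ ∘ₗ (antipodeB D R).rTensor _ ∘ₗ
    (comulB D R).toLinearMap) ((counitB D R).toLinearMap.smulRight 1)) ?_ ?_ ?_ x
  · simp [LinearMap.mem_eqLocus, Algebra.TensorProduct.one_def]
  · intro g t ht
    have ht : LinearMap.mul' k _ ((antipodeB D R).rTensor _ (comulB D R t)) =
      counitB D R t • 1 := ht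
    change LinearMap.mul' k _ ((antipodeB D R).rTensor _ (comulB D R _)) =
      counitB D R _ • (1 : Boson D R)
    rw [map_mul, rTensor_mul D R _ _ 1 (by simp [inG_inv_mul]), ht, map_mul, counitB_inG, one_mul,
      one_smul]
  · intro i t _
    change LinearMap.mul' k _ ((antipodeB D R).rTensor _ (comulB D R _)) =
      counitB D R _ • (1 : Boson D R)
    rw [map_mul, rTensor_mul D R _ _ 0 (by simp [xS]), map_mul, counitB_bE, zero_mul,
      zero_smul, zero_smul]

theorem antipodeB_right (x : Boson D R) :
    LinearMap.mul' k _ ((antipodeB D R).lTensor _ (comulB D R x)) = counitB D R x • 1 := by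
  have key : ∀ x y : Boson D R, LinearMap.mul' k _ ((antipodeB D R).lTensor _ (comulB D R y)) =
      counitB D R y • 1 → LinearMap.mul' k _ ((antipodeB D R).lTensor _ (comulB D R x)) =
      counitB D R x • 1 → LinearMap.mul' k _ ((antipodeB D R).lTensor _ (comulB D R (x * y))) =
      counitB D R (x * y) • 1 := by
    intro x y hy hx
    rw [map_mul, lTensor_mul D R _ _ _ hy, hx, smul_smul, map_mul, mul_comm]
  refine mem_of_gen (M := LinearMap.eqLocus (LinearMap.mul' k _ ∘ₗ (antipodeB D R).lTensor _ ∘ₗ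
    (comulB D R).toLinearMap) ((counitB D R).toLinearMap.smulRight 1)) ?_ ?_ ?_ x
  · simp [LinearMap.mem_eqLocus, Algebra.TensorProduct.one_def]
  · intro g t ht
    exact key _ _ ht (by simp [inG_mul_inv])
  · intro i t ht
    exact key _ _ ht (by simp [xS, ← mul_assoc, inG_mul_inv])

instance : HopfAlgebra k (Boson D R) where
  antipode := antipodeB D R
  mul_antipode_rTensor_comul := by
    ext x
    exact (antipodeB_left D R x).trans (Algebra.algebraMap_eq_smul_one _).symm
  mul_antipode_lTensor_comul := by
    ext x
    exact (antipodeB_right D R x).trans (Algebra.algebraMap_eq_smul_one _).symm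

/-- The canonical algebra map `T(V) # k[Γ] → R # k[Γ]`. -/
def canonicalAlgHom : Boson D (TV D) →ₐ[k] Boson D R :=
  lift ((inR D R).comp (proj (D := D))) (inG D R) fun g t => by
    rw [AlgHom.comp_apply, AlgHom.comp_apply, inG_mul_inR, BraidedQuotient.smul_proj]

@[simp] theorem canonicalAlgHom_inR (t : TV D) :
    canonicalAlgHom D R (inR D (TV D) t) = inR D R (proj t) := by
  rw [canonicalAlgHom, lift_inR, AlgHom.comp_apply]

@[simp] theorem canonicalAlgHom_bE (i : ι) :
    canonicalAlgHom D R (bE D (TV D) i) = bE D R i := canonicalAlgHom_inR D R _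

@[simp] theorem canonicalAlgHom_inG (g : Γ) :
    canonicalAlgHom D R (inG D (TV D) g) = inG D R g := by
  rw [canonicalAlgHom, lift_inG]

/-- The canonical Hopf algebra map `T(V) # k[Γ] → R # k[Γ]`. -/
def canonical : Boson D (TV D) →ₐc[k] Boson D R :=
  BialgHom.ofAlgHom (canonicalAlgHom D R) (algHom_ext (fun i => by simp) (fun g => by simp))
    (algHom_ext (fun i => by simp) (fun g => by simp))

end Boson

/-! ### The co-opposite Hopf algebra -/

/-- The co-opposite `H^cop` of `H`: the same algebra with the flipped coproduct. -/
def Cop (H : Type*) : Type _ := H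

namespace Cop

variable {H : Type*} [Ring H]

instance : Ring (Cop H) := inferInstanceAs (Ring H)

instance [Algebra k H] : Algebra k (Cop H) := inferInstanceAs (Algebra k H)

variable (k H) in
/-- The identity map, as an algebra isomorphism `H ≃ H^cop`. -/
def toCop [Algebra k H] : H ≃ₐ[k] Cop H := AlgEquiv.refl

section

variable [Bialgebra k H]

variable (k H) in
/-- The flipped coproduct. -/
def flipComul : H →ₗ[k] H ⊗[k] H :=
  (TensorProduct.comm k H H).toLinearMap ∘ₗ Coalgebra.comul

theorem flipComul_coassoc : (TensorProduct.assoc k H H H).toLinearMap ∘ₗ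
    (flipComul k H).rTensor H ∘ₗ flipComul k H = (flipComul k H).lTensor H ∘ₗ flipComul k H := by
  let τ : H ⊗[k] (H ⊗[k] H) →ₗ[k] H ⊗[k] (H ⊗[k] H) :=
    (TensorProduct.assoc k H H H).toLinearMap ∘ₗ
      (TensorProduct.comm k H (H ⊗[k] H)).toLinearMap ∘ₗ
        (TensorProduct.comm k H H).toLinearMap.lTensor H
  have h1 : (TensorProduct.assoc k H H H).toLinearMap ∘ₗ (flipComul k H).rTensor H ∘ₗ
      (TensorProduct.comm k H H).toLinearMap = τ ∘ₗ (Coalgebra.comul (R := k) (A := H)).lTensor H := by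
    ext x y
    simp [τ, flipComul]
  have h2 : (flipComul k H).lTensor H ∘ₗ (TensorProduct.comm k H H).toLinearMap =
      τ ∘ₗ (TensorProduct.assoc k H H H).toLinearMap ∘ₗ
        (Coalgebra.comul (R := k) (A := H)).rTensor H := by
    have h3 : τ ∘ₗ (TensorProduct.assoc k H H H).toLinearMap =
      (TensorProduct.comm k H H).toLinearMap.lTensor H ∘ₗ
        (TensorProduct.comm k (H ⊗[k] H) H).toLinearMap := by
      ext x y z
      simp [τ]
    rw [← LinearMap.comp_assoc, h3]
    ext x y
    simp [flipComul]
  ext x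
  have e1 := LinearMap.congr_fun h1 (Coalgebra.comul x)
  have e2 := LinearMap.congr_fun h2 (Coalgebra.comul x)
  have e3 := Coalgebra.coassoc_apply (R := k) x
  simp only [LinearMap.comp_apply, LinearEquiv.coe_coe] at e1 e2 e3 ⊢
  rw [show flipComul k H x = TensorProduct.comm k H H (Coalgebra.comul x) from rfl, e1, e2, e3]

theorem flipComul_mul (a b : H) : flipComul k H (a * b) = flipComul k H a * flipComul k H b := by
  have h : ∀ z w : H ⊗[k] H, TensorProduct.comm k H H (z * w) =
      TensorProduct.comm k H H z * TensorProduct.comm k H H w :=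
    map_mul (Algebra.TensorProduct.comm k H H)
  simp [flipComul, h]

variable (k H) in
/-- The co-opposite coalgebra structure, on `H` itself. -/
abbrev flipCoalgebra : Coalgebra k H where
  comul := flipComul k H
  counit := Coalgebra.counit
  coassoc := flipComul_coassoc
  rTensor_counit_comp_comul := by
    have h : (Coalgebra.counit (R := k) (A := H)).rTensor H ∘ₗ
      (TensorProduct.comm k H H).toLinearMap = (TensorProduct.comm k H k).toLinearMap ∘ₗ
        (Coalgebra.counit (R := k) (A := H)).lTensor H := by
      ext; simp
    rw [flipComul, ← LinearMap.comp_assoc, h, LinearMap.comp_assoc,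
      Coalgebra.lTensor_counit_comp_comul]
    ext; simp
  lTensor_counit_comp_comul := by
    have h : (Coalgebra.counit (R := k) (A := H)).lTensor H ∘ₗ
      (TensorProduct.comm k H H).toLinearMap = (TensorProduct.comm k k H).toLinearMap ∘ₗ
        (Coalgebra.counit (R := k) (A := H)).rTensor H := by
      ext; simp
    rw [flipComul, ← LinearMap.comp_assoc, h, LinearMap.comp_assoc,
      Coalgebra.rTensor_counit_comp_comul]
    ext; simp

instance : Coalgebra k (Cop H) := flipCoalgebra k H

instance : Bialgebra k (Cop H) :=
  Bialgebra.mk' k (Cop H) (Bialgebra.counit_one (R := k) (A := H))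
    (fun {a b} => Bialgebra.counit_mul (R := k) (A := H) a b)
    (by
      have : flipComul k H 1 = 1 := by simp [flipComul, Algebra.TensorProduct.one_def]
      exact this)
    (fun {a b} => flipComul_mul (H := H) a b)

theorem comul_toCop (x : H) : Coalgebra.comul (R := k) (toCop k H x) =
    TensorProduct.map (toCop k H).toLinearMap (toCop k H).toLinearMap
      (TensorProduct.comm k H H (Coalgebra.comul x)) := by
  have : TensorProduct.map (toCop k H).toLinearMap (toCop k H).toLinearMap =
    (LinearMap.id : H ⊗[k] H →ₗ[k] H ⊗[k] H) := TensorProduct.map_id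
  rw [this]
  rfl

end

/-- A Hopf algebra with bijective antipode. -/
class BijectiveAntipode (k H : Type*) [Field k] [Ring H] [HopfAlgebra k H] : Prop where
  bij : Function.Bijective (HopfAlgebra.antipode k (A := H))

section

variable [HopfAlgebra k H] [BijectiveAntipode k H]

variable (k H) in
/-- The inverse of the antipode. -/
def antipodeInv : H →ₗ[k] H :=
  (LinearEquiv.ofBijective (HopfAlgebra.antipode k (A := H)) BijectiveAntipode.bij).symm.toLinearMap

theorem antipode_antipodeInv (x : H) : HopfAlgebra.antipode k (antipodeInv k H x) = x :=
  LinearEquiv.apply_symm_apply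
    (LinearEquiv.ofBijective (HopfAlgebra.antipode k (A := H)) BijectiveAntipode.bij) x

theorem antipodeInv_left (x : H) : LinearMap.mul' k H
    ((antipodeInv k H).rTensor H (flipComul k H x)) = algebraMap k H (Coalgebra.counit x) := by
  apply (BijectiveAntipode.bij (k := k) (H := H)).injective
  have h : ∀ z : H ⊗[k] H, HopfAlgebra.antipode k (LinearMap.mul' k H
      ((antipodeInv k H).rTensor H (TensorProduct.comm k H H z))) =
      LinearMap.mul' k H ((HopfAlgebra.antipode k).rTensor H z) := by
    intro z
    induction z with
    | zero => simp
    | add a b ha hb => simp only [map_add, ha, hb]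
    | tmul a b => simp [HopfAlgebra.antipode_mul_antidistrib, antipode_antipodeInv]
  refine (h _).trans ?_
  rw [HopfAlgebra.mul_antipode_rTensor_comul_apply, Algebra.algebraMap_eq_smul_one, map_smul,
    HopfAlgebra.antipode_one]

theorem antipodeInv_right (x : H) : LinearMap.mul' k H
    ((antipodeInv k H).lTensor H (flipComul k H x)) = algebraMap k H (Coalgebra.counit x) := by
  apply (BijectiveAntipode.bij (k := k) (H := H)).injective
  have h : ∀ z : H ⊗[k] H, HopfAlgebra.antipode k (LinearMap.mul' k H
      ((antipodeInv k H).lTensor H (TensorProduct.comm k H H z))) =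
      LinearMap.mul' k H ((HopfAlgebra.antipode k).lTensor H z) := by
    intro z
    induction z with
    | zero => simp
    | add a b ha hb => simp only [map_add, ha, hb]
    | tmul a b => simp [HopfAlgebra.antipode_mul_antidistrib, antipode_antipodeInv]
  refine (h _).trans ?_
  rw [HopfAlgebra.mul_antipode_lTensor_comul_apply, Algebra.algebraMap_eq_smul_one, map_smul,
    HopfAlgebra.antipode_one]

/-- The antipode of `H^cop` is the inverse of the antipode of `H`. -/
instance : HopfAlgebra k (Cop H) where
  antipode := antipodeInv k H
  mul_antipode_rTensor_comul := LinearMap.ext (antipodeInv_left (H := H))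
  mul_antipode_lTensor_comul := LinearMap.ext (antipodeInv_right (H := H))

theorem antipode_toCop (x : H) : HopfAlgebra.antipode k (toCop k H x) =
    toCop k H (antipodeInv k H x) := rfl

end

theorem flipComul_map {H' : Type*} [Ring H'] [Bialgebra k H] [Bialgebra k H'] (f : H →ₐc[k] H')
    (x : H) : TensorProduct.map (f : H →ₗ[k] H') (f : H →ₗ[k] H') (flipComul k H x) =
      flipComul k H' (f x) := by
  have h : ∀ z : H ⊗[k] H, TensorProduct.map (f : H →ₗ[k] H') (f : H →ₗ[k] H')
      (TensorProduct.comm k H H z) =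
      TensorProduct.comm k H' H' (TensorProduct.map (f : H →ₗ[k] H') (f : H →ₗ[k] H') z) := by
    intro z
    induction z with
    | zero => simp
    | add a b ha hb => simp only [map_add, ha, hb]
    | tmul a b => simp
  refine (h _).trans ?_
  have := CoalgHomClass.map_comp_comul_apply f x
  exact congrArg (TensorProduct.comm k H' H') this

/-- A map of bialgebras is a map of the co-opposite bialgebras. -/
def map {H' : Type*} [Ring H'] [Bialgebra k H] [Bialgebra k H'] (f : H →ₐc[k] H') :
    Cop H →ₐc[k] Cop H' :=
  BialgHom.ofAlgHom
    (((toCop k H').toAlgHom.comp (f : H →ₐ[k] H')).comp (toCop k H).symm.toAlgHom)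
    (by
      ext x
      exact congrArg (fun g => g x) (BialgHom.counitAlgHom_comp f))
    (by
      ext x
      exact flipComul_map f x)

end Cop

instance (D : DiagonalYD k Γ ι) (R : Type*) [Ring R] [Algebra k R] [MulSemiringAction Γ R]
    [SMulCommClass Γ k R] [BraidedQuotient D R] : Cop.BijectiveAntipode k (Boson D R) where
  bij := Boson.antipodeB_bijective D R

/-! ### Skew-Hopf pairings -/

/-- A skew-Hopf pairing between Hopf algebras `A` and `B`. In Sweedler notation, the axioms
`mul_left` and `mul_right` say `μ(aa', b) = μ(a, b₍₂₎) μ(a', b₍₁₎)` and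
`μ(a, bb') = μ(a₍₁₎, b) μ(a₍₂₎, b')`. When the antipode of `B` is bijective, the last axiom is
equivalent to `μ(S(a), b) = μ(a, S⁻¹(b))`. -/
structure IsSkewHopfPairing {A B : Type*} [Ring A] [Ring B] [HopfAlgebra k A] [HopfAlgebra k B]
    (μ : A →ₗ[k] B →ₗ[k] k) : Prop where
  one_left : ∀ b, μ 1 b = Coalgebra.counit b
  one_right : ∀ a, μ a 1 = Coalgebra.counit a
  mul_left : ∀ a a' b, μ (a * a') b =
    LinearMap.mul' k k (TensorProduct.map (μ a') (μ a) (Coalgebra.comul b))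
  mul_right : ∀ a b b', μ a (b * b') =
    LinearMap.mul' k k (TensorProduct.map (μ.flip b) (μ.flip b') (Coalgebra.comul a))
  antipode : ∀ a b, μ (HopfAlgebra.antipode k a) (HopfAlgebra.antipode k b) = μ a b

/-- The data: a matrix `q`, abelian groups `Γ` and `Λ` with elements `g i`, `h i` and characters
`γ i`, `lam i`, and a bilinear form `form : Γ × Λ → kˣ`. The fields `γ_eq` and `lam_eq` hold
automatically on the subgroups generated by the `g i` and the `h i` respectively. -/
structure Datum (k Γ Λ : Type*) [Field k] [CommGroup Γ] [CommGroup Λ] (θ : ℕ) where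
  q : Fin θ → Fin θ → kˣ
  g : Fin θ → Γ
  γ : Fin θ → Γ →* kˣ
  h : Fin θ → Λ
  lam : Fin θ → Λ →* kˣ
  form : Γ →* Λ →* kˣ
  γ_g : ∀ i j, γ j (g i) = q i j
  lam_h : ∀ i j, lam j (h i) = q j i
  form_g_h : ∀ i j, form (g i) (h j) = q i j
  γ_eq : ∀ i x, γ i x = form x (h i)
  lam_eq : ∀ i y, lam i y = form (g i) y

namespace Datum

variable {Λ : Type*} [CommGroup Λ] {θ : ℕ} (e : Datum k Γ Λ θ)

/-- The Yetter-Drinfeld module `V` over `k[Γ]`, with basis `E i` of degree `g i` and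
character `γ i`. -/
def V : DiagonalYD k Γ (Fin θ) := ⟨e.g, e.γ⟩

/-- The Yetter-Drinfeld module `W` over `k[Λ]`, with basis `F i` of degree `h i` and
character `lam i`. -/
def W : DiagonalYD k Λ (Fin θ) := ⟨e.h, e.lam⟩

/-- `T(V) # k[Γ]`. -/
abbrev TensorPos : Type _ := Boson e.V (TV e.V)

/-- `(T(W) # k[Λ])^cop`. -/
abbrev TensorNeg : Type _ := Cop (Boson e.W (TV e.W))

/-- `B(V) # k[Γ]`. -/
abbrev NicholsPos : Type _ := Boson e.V (Nichols e.V)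

/-- `(B(W) # k[Λ])^cop`. -/
abbrev NicholsNeg : Type _ := Cop (Boson e.W (Nichols e.W))

/-- The inclusion `T(V) → T(V) # k[Γ]`. -/
def inTV : TV e.V →ₐ[k] e.TensorPos := Boson.inR e.V (TV e.V)

/-- The inclusion `Γ → T(V) # k[Γ]`. -/
def inΓ : Γ →* e.TensorPos := Boson.inG e.V (TV e.V)

/-- The inclusion `T(W) → (T(W) # k[Λ])^cop`. -/
def inTW : TV e.W →ₐ[k] e.TensorNeg :=
  (Cop.toCop k (Boson e.W (TV e.W))).toAlgHom.comp (Boson.inR e.W (TV e.W))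

/-- The inclusion `Λ → (T(W) # k[Λ])^cop`. -/
def inΛ : Λ →* e.TensorNeg :=
  ((Cop.toCop k (Boson e.W (TV e.W))) : _ →* e.TensorNeg).comp (Boson.inG e.W (TV e.W))

/-- The inclusion `B(V) → B(V) # k[Γ]`. -/
def inBV : Nichols e.V →ₐ[k] e.NicholsPos := Boson.inR e.V (Nichols e.V)

/-- The inclusion `B(W) → (B(W) # k[Λ])^cop`. -/
def inBW : Nichols e.W →ₐ[k] e.NicholsNeg :=
  (Cop.toCop k (Boson e.W (Nichols e.W))).toAlgHom.comp (Boson.inR e.W (Nichols e.W))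

/-- The canonical Hopf algebra map `T(V) # k[Γ] → B(V) # k[Γ]`. -/
def projV : e.TensorPos →ₐc[k] e.NicholsPos := Boson.canonical e.V (Nichols e.V)

/-- The canonical Hopf algebra map `(T(W) # k[Λ])^cop → (B(W) # k[Λ])^cop`. -/
def projW : e.TensorNeg →ₐc[k] e.NicholsNeg := Cop.map (Boson.canonical e.W (Nichols e.W))

/-- The skew-Hopf pairings `T(V) # k[Γ] ⊗ (T(W) # k[Λ])^cop → k` with the prescribed values. -/
structure IsTensorPairing (μ : e.TensorPos →ₗ[k] e.TensorNeg →ₗ[k] k) : Prop where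
  isSkewHopfPairing : IsSkewHopfPairing μ
  group_group : ∀ x y, μ (e.inΓ x) (e.inΛ y) = e.form x y
  E_F : ∀ i j, μ (e.inTV (E e.V i)) (e.inTW (E e.W j)) = if i = j then -1 else 0
  E_group : ∀ i y, μ (e.inTV (E e.V i)) (e.inΛ y) = 0
  group_F : ∀ x j, μ (e.inΓ x) (e.inTW (E e.W j)) = 0
  mul_mul : ∀ (s : TV e.V) (t : TV e.W) (x : Γ) (y : Λ),
    μ (e.inTV s * e.inΓ x) (e.inTW t * e.inΛ y) =
      μ (e.inTV s) (e.inTW t) * μ (e.inΓ x) (e.inΛ y)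

/-- The bilinear form on `Γ × Λ` has trivial left and right kernels. -/
def FormNondegenerate : Prop :=
  (∀ x, (∀ y, e.form x y = 1) → x = 1) ∧ (∀ y, (∀ x, e.form x y = 1) → y = 1)

end Datum

end SkewPairing

end

/-!
The pairing is constructed and studied in the symmetric form in which the co-opposite coproduct is
undone: a skew-Hopf pairing of `A` with `H^cop` is a bilinear form on `A × H` for which the
multiplication on each side is dual to the comultiplication on the other. The compatibility with
the antipodes is then automatic, because in the convolution algebra of linear forms on `A ⊗ H`
both `β(S(a), b)` and `β(a, S(b))` are inverse to `β` (`IsBialgebraPairing.antipode_left`).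

*Existence and uniqueness on the tensor algebras.* Such a form is an algebra map from
`A = T(V) # k[Γ]` to the convolution algebra of linear forms on `H = T(W) # k[Λ]`. By the universal
property of `A` it suffices to give the images of the generators: `g` goes to the character of `H`
that extends `form g` by zero on `W`, and `E i` goes to a skew derivation of `H`, an entry of
a representation by upper triangular matrices of size two. The relation `g E i = γ i (g) E i g` is
checked in the dual (`groupChar_convMul_skewDer`). The other compatibility, with products in `H`,
holds on generators and is inherited by products (`IsBialgebraPairing.mul_right_of_mul`).

*The radical.* Restricted to `T(V) × T(W)`, the form turns products into the braided coproduct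
(`IsBosonPairing.tensorForm_mul`) and is homogeneous with respect to the content of words
(`IsBosonPairing.tensorForm_word_word`). Hence its left radical is a two-sided ideal and a coideal,
and it is spanned by elements of homogeneous content, on which `Γ` acts by scalars and which are
homogeneous for the coaction. The form is non-degenerate in degrees zero and one, so the radical
lives in degrees at least two and is contained in the ideal `I(V)`. Conversely `I(V)` pairs to zero
with all words, by induction on their length. So `I(V)` is exactly the radical
(`IsBosonPairing.nicholsIdeal_eq_radical`).

*Descent and non-degeneracy.* The algebra map from `A` to the convolution algebra therefore factors
through `B(V) # k[Γ]`, and likewise on the other side, which gives `ν`; it is non-degenerate on the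
Nichols algebras because the whole radical has been divided out. A radical element `∑ r g # g` of
`B(V) # k[Γ]` satisfies `∑ ν(r g, s) form(g, y) = 0` for all `s` and `y`. If distinct `g` give
distinct characters `form g`, these are linearly independent, so that all `r g` vanish
(`IsBosonPairing.descended_separatingLeft`). If `form x = 1`, then `x - 1` is in the radical of `ν`.
-/

noncomputable section

namespace SkewPairing

variable {k : Type*} [Field k]

/-! ### Pairings of bialgebras -/

/-- A pairing of bialgebras: the multiplication of each factor is dual to the comultiplication of
the other. A skew-Hopf pairing of `A` with `H^cop` is the same thing as such a pairing of `A`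
with `H`. This formulation is symmetric in the two factors. -/
structure IsBialgebraPairing {A H : Type*} [Ring A] [Ring H] [Bialgebra k A] [Bialgebra k H]
    (β : A →ₗ[k] H →ₗ[k] k) : Prop where
  one_left : ∀ b, β 1 b = Coalgebra.counit b
  one_right : ∀ a, β a 1 = Coalgebra.counit a
  mul_left : ∀ a a' b, β (a * a') b =
    LinearMap.mul' k k (TensorProduct.map (β a) (β a') (Coalgebra.comul b))
  mul_right : ∀ a b b', β a (b * b') =
    LinearMap.mul' k k (TensorProduct.map (β.flip b) (β.flip b') (Coalgebra.comul a))

theorem mul'_map_comm {M N : Type*} [AddCommGroup M] [AddCommGroup N] [Module k M] [Module k N]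
    (f : N →ₗ[k] k) (g : M →ₗ[k] k) (z : M ⊗[k] N) :
    LinearMap.mul' k k (TensorProduct.map f g (TensorProduct.comm k M N z)) =
      LinearMap.mul' k k (TensorProduct.map g f z) := by
  induction z with
  | zero => simp
  | add a b ha hb => simp only [map_add, ha, hb]
  | tmul a b => simp [mul_comm]

/-- The formula for the product of two linear forms on a tensor product pulled back along linear
maps. -/
theorem mul'_map_map {M N M' N' : Type*} [AddCommGroup M] [AddCommGroup N] [AddCommGroup M']
    [AddCommGroup N'] [Module k M] [Module k N] [Module k M'] [Module k N']
    (f : M' →ₗ[k] k) (g : N' →ₗ[k] k) (p : M →ₗ[k] M') (q : N →ₗ[k] N') (z : M ⊗[k] N) :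
    LinearMap.mul' k k (TensorProduct.map f g (TensorProduct.map p q z)) =
      LinearMap.mul' k k (TensorProduct.map (f ∘ₗ p) (g ∘ₗ q) z) := by
  rw [TensorProduct.map_comp, LinearMap.comp_apply]

theorem exists_sum_tmul {M N : Type*} [AddCommGroup M] [AddCommGroup N] [Module k M] [Module k N]
    (z : M ⊗[k] N) : ∃ S : Finset (M × N), z = ∑ i ∈ S, i.1 ⊗ₜ i.2 :=
  TensorProduct.exists_finset z

namespace IsBialgebraPairing

section

variable {A H : Type*} [Ring A] [Ring H] [Bialgebra k A] [Bialgebra k H]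
  {β : A →ₗ[k] H →ₗ[k] k}

protected theorem flip (hβ : IsBialgebraPairing β) : IsBialgebraPairing β.flip where
  one_left := hβ.one_right
  one_right := hβ.one_left
  mul_left b b' a := hβ.mul_right a b b'
  mul_right b a a' := hβ.mul_left a a' b

/-- A pairing descends along surjective bialgebra maps whose kernels lie in its radicals. -/
theorem descend {A' H' : Type*} [Ring A'] [Ring H'] [Bialgebra k A'] [Bialgebra k H']
    (hβ : IsBialgebraPairing β) (p : A →ₐc[k] A') (q : H →ₐc[k] H')
    (hp : Function.Surjective p) (hq : Function.Surjective q) {ν : A' →ₗ[k] H' →ₗ[k] k}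
    (hν : ∀ a b, ν (p a) (q b) = β a b) : IsBialgebraPairing ν where
  one_left b := by
    obtain ⟨b, rfl⟩ := hq b
    rw [← map_one p, hν, hβ.one_left]
    exact (CoalgHomClass.counit_comp_apply q b).symm
  one_right a := by
    obtain ⟨a, rfl⟩ := hp a
    rw [← map_one q, hν, hβ.one_right]
    exact (CoalgHomClass.counit_comp_apply p a).symm
  mul_left a a' b := by
    obtain ⟨a, rfl⟩ := hp a
    obtain ⟨a', rfl⟩ := hp a'
    obtain ⟨b, rfl⟩ := hq b
    have h1 : ∀ a, ν (p a) ∘ₗ (q : H →ₗ[k] H') = β a := fun a => LinearMap.ext fun b => hν a b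
    rw [← map_mul, hν, hβ.mul_left, ← CoalgHomClass.map_comp_comul_apply q b, mul'_map_map,
      h1, h1]
  mul_right a b b' := by
    obtain ⟨a, rfl⟩ := hp a
    obtain ⟨b, rfl⟩ := hq b
    obtain ⟨b', rfl⟩ := hq b'
    have h1 : ∀ b, ν.flip (q b) ∘ₗ (p : A →ₗ[k] A') = β.flip b :=
      fun b => LinearMap.ext fun a => hν a b
    rw [← map_mul, hν, hβ.mul_right, ← CoalgHomClass.map_comp_comul_apply p a, mul'_map_map,
      h1, h1]

/-- The compatibility with products in the second variable is inherited by products in the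
first variable, as the comultiplications are multiplicative. -/
theorem mul_right_of_mul {β : A →ₗ[k] H →ₗ[k] k} (hl : ∀ a a' b, β (a * a') b =
      LinearMap.mul' k k (TensorProduct.map (β a) (β a') (Coalgebra.comul b))) {x t : A}
    (hx : ∀ b b', β x (b * b') =
      LinearMap.mul' k k (TensorProduct.map (β.flip b) (β.flip b') (Coalgebra.comul x)))
    (ht : ∀ b b', β t (b * b') =
      LinearMap.mul' k k (TensorProduct.map (β.flip b) (β.flip b') (Coalgebra.comul t)))
    (b b' : H) : β (x * t) (b * b') =
      LinearMap.mul' k k (TensorProduct.map (β.flip b) (β.flip b') (Coalgebra.comul (x * t))) := by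
  rw [hl, Bialgebra.comul_mul, Bialgebra.comul_mul]
  obtain ⟨X, hX⟩ := exists_sum_tmul (Coalgebra.comul (R := k) x)
  obtain ⟨T, hT⟩ := exists_sum_tmul (Coalgebra.comul (R := k) t)
  obtain ⟨Z, hZ⟩ := exists_sum_tmul (Coalgebra.comul (R := k) b)
  obtain ⟨W, hW⟩ := exists_sum_tmul (Coalgebra.comul (R := k) b')
  simp only [hX, hT, hZ, hW, Finset.sum_mul_sum, map_sum, Algebra.TensorProduct.tmul_mul_tmul,
    TensorProduct.map_tmul, LinearMap.mul'_apply, LinearMap.flip_apply, hx, ht, hl,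
    Finset.sum_mul_sum]
  have hcomm : ∀ f : H × H → H × H → A × A → A × A → k,
      ∑ z ∈ Z, ∑ w ∈ W, ∑ m ∈ X, ∑ u ∈ T, f z w m u =
        ∑ m ∈ X, ∑ u ∈ T, ∑ z ∈ Z, ∑ w ∈ W, f z w m u := by
    intro f
    rw [← Finset.sum_product' Z W, ← Finset.sum_product' X T]
    simp_rw [← Finset.sum_product' X T, ← Finset.sum_product' Z W]
    exact Finset.sum_comm
  rw [hcomm]
  refine Finset.sum_congr rfl fun _ _ => Finset.sum_congr rfl fun _ _ =>
    Finset.sum_congr rfl fun _ _ => Finset.sum_congr rfl fun _ _ => by ring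

end

section Antipode

variable {A H : Type*} [Ring A] [Ring H] [HopfAlgebra k A] [HopfAlgebra k H]
  {β : A →ₗ[k] H →ₗ[k] k}

open TensorProduct in
/-- In the convolution algebra of linear forms on `A ⊗ H`, both `β(S(a), b)` and `β(a, S(b))` are
inverse to `β`, hence they agree. -/
theorem antipode_left (hβ : IsBialgebraPairing β) (a : A) (b : H) :
    β (HopfAlgebra.antipode k a) b = β a (HopfAlgebra.antipode k b) := by
  have hone : (1 : WithConv (A ⊗[k] H →ₗ[k] k)) = WithConv.toConv (TensorProduct.lift
      ((LinearMap.mul k k).compl₁₂ Coalgebra.counit Coalgebra.counit)) := by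
    refine WithConv.ext (TensorProduct.ext' fun a b => ?_)
    simp [LinearMap.convOne_def, mul_comm]
  have hL : WithConv.toConv (TensorProduct.lift (β.compl₂ (HopfAlgebra.antipode k))) *
      WithConv.toConv (TensorProduct.lift β) = (1 : WithConv (A ⊗[k] H →ₗ[k] k)) := by
    rw [hone]
    refine WithConv.ext (TensorProduct.ext' fun a b => ?_)
    have h := hβ.mul_right a
    have h' := congrArg (β a) (HopfAlgebra.mul_antipode_rTensor_comul_apply (R := k) b)
    obtain ⟨X, hX⟩ := exists_sum_tmul (Coalgebra.comul (R := k) a)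
    obtain ⟨Z, hZ⟩ := exists_sum_tmul (Coalgebra.comul (R := k) b)
    rw [Algebra.algebraMap_eq_smul_one, map_smul, hβ.one_right] at h'
    simp only [hX, hZ, map_sum, LinearMap.rTensor_tmul, LinearMap.mul'_apply, h,
      TensorProduct.map_tmul, LinearMap.flip_apply] at h'
    simp [LinearMap.convMul_def, TensorProduct.comul_tmul, hX, hZ, TensorProduct.tmul_sum,
      TensorProduct.sum_tmul, h']
    exact mul_comm _ _
  have hR : WithConv.toConv (TensorProduct.lift β) *
      WithConv.toConv (TensorProduct.lift (β ∘ₗ HopfAlgebra.antipode k)) =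
        (1 : WithConv (A ⊗[k] H →ₗ[k] k)) := by
    rw [hone]
    refine WithConv.ext (TensorProduct.ext' fun a b => ?_)
    have h := hβ.mul_left
    have h' := congrArg (β.flip b) (HopfAlgebra.mul_antipode_lTensor_comul_apply (R := k) a)
    obtain ⟨X, hX⟩ := exists_sum_tmul (Coalgebra.comul (R := k) a)
    obtain ⟨Z, hZ⟩ := exists_sum_tmul (Coalgebra.comul (R := k) b)
    rw [Algebra.algebraMap_eq_smul_one, map_smul, LinearMap.flip_apply, LinearMap.flip_apply,
      hβ.one_left] at h'
    simp only [hX, hZ, map_sum, LinearMap.sum_apply, LinearMap.lTensor_tmul,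
      LinearMap.mul'_apply, h,
      TensorProduct.map_tmul] at h'
    simp [LinearMap.convMul_def, TensorProduct.comul_tmul, hX, hZ, TensorProduct.tmul_sum,
      TensorProduct.sum_tmul]
    rw [Finset.sum_comm]
    exact h'
  have key := congrArg WithConv.ofConv (left_inv_eq_right_inv hL hR)
  exact (LinearMap.congr_fun key (a ⊗ₜ b)).symm

end Antipode

end IsBialgebraPairing

/-! ### Skew-Hopf pairings as pairings of bialgebras -/

/-- A bilinear form on `A × H`, viewed as a form on `A × H^cop`. -/
def toCopForm {A H : Type*} [Ring A] [Ring H] [Algebra k A] [Algebra k H] :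
    (A →ₗ[k] H →ₗ[k] k) ≃ₗ[k] (A →ₗ[k] Cop H →ₗ[k] k) :=
  LinearEquiv.congrRight (LinearEquiv.congrLeft k k (Cop.toCop k H).toLinearEquiv)

/-- Passing to the co-opposite of the second factor turns pairings of bialgebras into skew-Hopf
pairings. The compatibility with the antipodes comes for free, as the antipode of `H^cop` is the
inverse of that of `H`. -/
theorem isSkewHopfPairing_toCopForm {A H : Type*} [Ring A] [Ring H] [HopfAlgebra k A]
    [HopfAlgebra k H] [Cop.BijectiveAntipode k H] {β : A →ₗ[k] H →ₗ[k] k} :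
    IsSkewHopfPairing (toCopForm β) ↔ IsBialgebraPairing β := by
  have hmul : ∀ a a' (b : H), LinearMap.mul' k k (TensorProduct.map (toCopForm β a')
      (toCopForm β a) (Coalgebra.comul (Cop.toCop k H b))) =
      LinearMap.mul' k k (TensorProduct.map (β a) (β a') (Coalgebra.comul b)) := by
    intro a a' b
    rw [Cop.comul_toCop, mul'_map_map, mul'_map_comm]
    rfl
  constructor
  · intro h
    exact {
      one_left := fun b => h.one_left (Cop.toCop k H b)
      one_right := fun a => h.one_right a
      mul_left := fun a a' b => (h.mul_left a a' (Cop.toCop k H b)).trans (hmul a a' b)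
      mul_right := fun a b b' => h.mul_right a (Cop.toCop k H b) (Cop.toCop k H b') }
  · intro h
    exact {
      one_left := fun b => h.one_left ((Cop.toCop k H).symm b)
      one_right := fun a => h.one_right a
      mul_left := fun a a' b => (h.mul_left a a' _).trans (hmul a a' ((Cop.toCop k H).symm b)).symm
      mul_right := fun a b b' => h.mul_right a ((Cop.toCop k H).symm b) ((Cop.toCop k H).symm b')
      antipode := fun a b => by
        obtain ⟨b, rfl⟩ := (Cop.toCop k H).surjective b
        exact (h.antipode_left a (Cop.antipodeInv k H b)).trans
          (congrArg (β a) (Cop.antipode_antipodeInv b)) }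

/-! ### Construction of the pairing of the bosonizations of the tensor algebras -/

section

variable {Γ Λ ι : Type*} [CommGroup Γ] [CommGroup Λ]

namespace Boson

open BraidedQuotient (proj)

/-- The relations `g E i = D.char i g • E i g` imply the compatibility of an algebra map on `T(V)` with
a map on `Γ` that is needed for the smash product. -/
theorem liftE_smul_mul {D : DiagonalYD k Γ ι} {A : Type*} [Ring A] [Algebra k A] (f : ι → A)
    (u : Γ →* A) (h : ∀ g i, u g * f i = (D.char i g : k) • (f i * u g)) (g : Γ) (t : TV D) :
    liftE D f (g • t) * u g = u g * liftE D f t := by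
  refine TV_mem (D := D) (M := LinearMap.eqLocus
    (LinearMap.mulRight k (u g) ∘ₗ (liftE D f).toLinearMap ∘ₗ (act D g).toLinearMap)
    (LinearMap.mulLeft k (u g) ∘ₗ (liftE D f).toLinearMap)) ?_ ?_ t
  · simp [LinearMap.mem_eqLocus]
  · intro i s hs
    have hs : liftE D f (g • s) * u g = u g * liftE D f s := hs
    change liftE D f (g • (E D i * s)) * u g = u g * liftE D f (E D i * s)
    rw [smul_mul', map_mul, mul_assoc, hs, map_mul, ← mul_assoc, ← mul_assoc, smul_E, map_smul,
      liftE_E, h, smul_mul_assoc (D.char i g : k) (f i)]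

/-- The algebra map out of `T(V) # k[Γ]` with prescribed values on the generators. -/
def liftGen (D : DiagonalYD k Γ ι) {A : Type*} [Ring A] [Algebra k A] (f : ι → A) (u : Γ →* A)
    (h : ∀ g i, u g * f i = (D.char i g : k) • (f i * u g)) : Boson D (TV D) →ₐ[k] A :=
  lift (liftE D f) u (liftE_smul_mul f u h)

section

variable {D : DiagonalYD k Γ ι} {A : Type*} [Ring A] [Algebra k A] (f : ι → A) (u : Γ →* A)
    (h : ∀ g i, u g * f i = (D.char i g : k) • (f i * u g))

@[simp] theorem liftGen_inR (t : TV D) : liftGen D f u h (inR D (TV D) t) = liftE D f t :=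
  lift_inR ..

@[simp] theorem liftGen_bE (i : ι) : liftGen D f u h (bE D (TV D) i) = f i :=
  (liftGen_inR f u h _).trans (liftE_E f i)

@[simp] theorem liftGen_inG (g : Γ) : liftGen D f u h (inG D (TV D) g) = u g :=
  lift_inG ..

end

theorem bE_TV (D : DiagonalYD k Γ ι) (i : ι) : bE D (TV D) i = inR D (TV D) (E D i) := rfl

/-- Induction on words in the generators of the bosonization. -/
theorem gen_induction {D : DiagonalYD k Γ ι} {R : Type*} [Ring R] [Algebra k R]
    [MulSemiringAction Γ R] [SMulCommClass Γ k R] [BraidedQuotient D R] {M : Type*}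
    [AddCommGroup M] [Module k M] {f f' : Boson D R →ₗ[k] M} (h1 : f 1 = f' 1)
    (hG : ∀ g t, f t = f' t → f (inG D R g * t) = f' (inG D R g * t))
    (hE : ∀ i t, f t = f' t → f (bE D R i * t) = f' (bE D R i * t)) : f = f' :=
  LinearMap.ext fun x => mem_of_gen (M := LinearMap.eqLocus f f') h1 hG hE x

end Boson

variable (D : DiagonalYD k Γ ι) (D' : DiagonalYD k Λ ι)

/-- The Yetter-Drinfeld modules `D` and `D'` are dual to each other with respect to the bilinear
form `form` on `Γ × Λ`: each character of one is the form evaluated at a degree of the other. -/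
structure IsDualPair (form : Γ →* Λ →* kˣ) : Prop where
  char_left : ∀ i x, D.char i x = form x (D'.grp i)
  char_right : ∀ i y, D'.char i y = form (D.grp i) y

variable {D D'} in
theorem IsDualPair.flip {form : Γ →* Λ →* kˣ} (h : IsDualPair D D' form) :
    IsDualPair D' D form.flip where
  char_left := h.char_right
  char_right := h.char_left

/-- The character of the bosonization that extends a character of the group and vanishes on
the `E i`. -/
def groupChar (χ : Γ →* kˣ) : Boson D (TV D) →ₐ[k] k :=
  Boson.liftGen D (fun _ => 0) ((Units.coeHom k).comp χ) fun _ _ => by simp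

@[simp] theorem groupChar_inG (χ : Γ →* kˣ) (g : Γ) :
    groupChar D χ (Boson.inG D (TV D) g) = χ g := by
  simp [groupChar]

@[simp] theorem groupChar_bE (χ : Γ →* kˣ) (i : ι) : groupChar D χ (Boson.bE D (TV D) i) = 0 := by
  simp [groupChar]

theorem groupChar_one (x : Boson D (TV D)) : groupChar D 1 x = Coalgebra.counit x := by
  have : groupChar D 1 = Boson.counitB D (TV D) := Boson.algHom_ext (by simp) (by simp)
  exact congrArg (fun f => f x) this

section skewDer

variable [DecidableEq ι]

/-- The upper triangular representation of the bosonization on `k²` with the character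
`groupChar χ` and the counit on the diagonal. Its entry above the diagonal is a skew derivation. -/
def skewDerRep (i : ι) : Boson D (TV D) →ₐ[k] Matrix (Fin 2) (Fin 2) k :=
  Boson.liftGen D (fun j => !![0, if i = j then -1 else 0; 0, 0])
    { toFun := fun g => !![(D.char i g : k), 0; 0, 1]
      map_one' := by simp [Matrix.one_fin_two]
      map_mul' := fun g h => by simp } fun g j => by
    by_cases h : i = j
    · subst h
      simp [Matrix.smul_of]
    · simp [h]

theorem skewDerRep_apply (i : ι) (x : Boson D (TV D)) :
    skewDerRep D i x = !![groupChar D (D.char i) x, skewDerRep D i x 0 1; 0, Coalgebra.counit x] := by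
  have hE : ∀ j, skewDerRep D i (Boson.bE D (TV D) j) = !![0, if i = j then -1 else 0; 0, 0] :=
    fun j => by simp [skewDerRep]
  have hG : ∀ g, skewDerRep D i (Boson.inG D (TV D) g) = !![(D.char i g : k), 0; 0, 1] :=
    fun g => by simp [skewDerRep]
  have h10 : ∀ x, skewDerRep D i x 1 0 = 0 := fun x => LinearMap.congr_fun
    (Boson.gen_induction (f := Matrix.entryLinearMap k k 1 0 ∘ₗ (skewDerRep D i).toLinearMap)
      (f' := 0) (by simp) (fun g t ht => by simpa [hG, Matrix.vecMul, dotProduct] using ht)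
      (fun j t ht => by simp [hE, Matrix.vecMul, dotProduct])) x
  have h00 : ∀ x, skewDerRep D i x 0 0 = groupChar D (D.char i) x := fun x => LinearMap.congr_fun
    (Boson.gen_induction (f := Matrix.entryLinearMap k k 0 0 ∘ₗ (skewDerRep D i).toLinearMap)
      (f' := (groupChar D (D.char i)).toLinearMap) (by simp)
      (fun g t ht => by simp_all [Matrix.vecMul, dotProduct])
      (fun j t ht => by simp [hE, Matrix.vecMul, dotProduct, h10])) x
  have h11 : ∀ x, skewDerRep D i x 1 1 = groupChar D 1 x := fun x => LinearMap.congr_fun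
    (Boson.gen_induction (f := Matrix.entryLinearMap k k 1 1 ∘ₗ (skewDerRep D i).toLinearMap)
      (f' := (groupChar D 1).toLinearMap) (by simp)
      (fun g t ht => by simpa [hG, Matrix.vecMul, dotProduct] using ht)
      (fun j t ht => by simp [hE, Matrix.vecMul, dotProduct])) x
  ext a b
  fin_cases a <;> fin_cases b <;> simp [h10, h00, h11, groupChar_one]

/-- The skew derivation of the bosonization that sends `E i` to `-1` and vanishes on the other
generators. -/
def skewDer (i : ι) : Boson D (TV D) →ₗ[k] k :=
  Matrix.entryLinearMap k k 0 1 ∘ₗ (skewDerRep D i).toLinearMap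

@[simp] theorem skewDer_inG (i : ι) (g : Γ) : skewDer D i (Boson.inG D (TV D) g) = 0 := by
  simp [skewDer, skewDerRep]

@[simp] theorem skewDer_bE (i j : ι) :
    skewDer D i (Boson.bE D (TV D) j) = if i = j then -1 else 0 := by
  simp [skewDer, skewDerRep]

@[simp] theorem skewDer_one (i : ι) : skewDer D i 1 = 0 := by
  rw [← map_one (Boson.inG D (TV D)), skewDer_inG]

theorem skewDer_mul (i : ι) (x y : Boson D (TV D)) : skewDer D i (x * y) =
    skewDer D i x * Coalgebra.counit y + groupChar D (D.char i) x * skewDer D i y := by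
  have : skewDer D i (x * y) = (skewDerRep D i x * skewDerRep D i y) 0 1 := by
    simp [skewDer]
  rw [this, skewDerRep_apply D i x, skewDerRep_apply D i y]
  simp [skewDer, add_comm]

end skewDer

section Convolution

theorem groupChar_convMul (χ χ' : Γ →* kˣ) :
    WithConv.toConv (groupChar D χ).toLinearMap * WithConv.toConv (groupChar D χ').toLinearMap =
      WithConv.toConv (groupChar D (χ * χ')).toLinearMap := by
  have h : (Algebra.TensorProduct.lmul' k).comp ((Algebra.TensorProduct.map (groupChar D χ)
      (groupChar D χ')).comp (Boson.comulB D (TV D))) = groupChar D (χ * χ') :=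
    Boson.algHom_ext (by simp) (by simp)
  refine WithConv.ext (LinearMap.ext fun x => ?_)
  exact congrArg (fun f => f x) h

variable [DecidableEq ι]

variable {D D'} in
/-- The relation `g E i = D.char i g • E i g` holds for the corresponding linear forms on the dual
bosonization. -/
theorem groupChar_convMul_skewDer {form : Γ →* Λ →* kˣ} (h : IsDualPair D D' form) (g : Γ) (i : ι) :
    WithConv.toConv (groupChar D' (form g)).toLinearMap * WithConv.toConv (skewDer D' i) =
      (D.char i g : k) • (WithConv.toConv (skewDer D' i) *
        WithConv.toConv (groupChar D' (form g)).toLinearMap) := by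
  refine WithConv.ext ?_
  let χ := groupChar D' (form g)
  refine Boson.gen_induction (f := LinearMap.mul' k k ∘ₗ TensorProduct.map χ.toLinearMap
    (skewDer D' i) ∘ₗ Coalgebra.comul) (f' := (D.char i g : k) • (LinearMap.mul' k k ∘ₗ
      TensorProduct.map (skewDer D' i) χ.toLinearMap ∘ₗ Coalgebra.comul)) ?_ ?_ ?_
  · simp [Algebra.TensorProduct.one_def]
  · intro y t ht
    -- Left multiplication by a group element rescales both sides by the same factor.
    have h1 : ∀ z, LinearMap.mul' k k (TensorProduct.map χ.toLinearMap (skewDer D' i)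
        ((Boson.inG D' (TV D') y ⊗ₜ Boson.inG D' (TV D') y) * z)) =
        (form g y * D'.char i y : k) *
          LinearMap.mul' k k (TensorProduct.map χ.toLinearMap (skewDer D' i) z) := by
      intro z
      induction z with
      | zero => simp
      | add a b ha hb => simp only [map_add, mul_add, ha, hb]
      | tmul a b =>
        simp [skewDer_mul, χ]
        ring
    have h2 : ∀ z, LinearMap.mul' k k (TensorProduct.map (skewDer D' i) χ.toLinearMap
        ((Boson.inG D' (TV D') y ⊗ₜ Boson.inG D' (TV D') y) * z)) =
        (form g y * D'.char i y : k) *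
          LinearMap.mul' k k (TensorProduct.map (skewDer D' i) χ.toLinearMap z) := by
      intro z
      induction z with
      | zero => simp
      | add a b ha hb => simp only [map_add, mul_add, ha, hb]
      | tmul a b =>
        simp [skewDer_mul, χ]
        ring
    simp only [LinearMap.comp_apply, LinearMap.smul_apply, Bialgebra.comul_mul, Boson.comul_inG,
      h1, h2] at ht ⊢
    rw [ht, mul_smul_comm]
  · intro j t _
    -- On a product `E j * t` both sides reduce to a multiple of `χ t`, with factors that agree
    -- because `D.char i g = form g (D'.grp i)`.
    have h1 : ∀ z, LinearMap.mul' k k (TensorProduct.map χ.toLinearMap (skewDer D' i)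
        ((Boson.bE D' (TV D') j ⊗ₜ 1 + Boson.inG D' (TV D') (D'.grp j) ⊗ₜ Boson.bE D' (TV D') j) *
          z)) = (if i = j then -form g (D'.grp j) else 0 : k) * LinearMap.mul' k k
            (TensorProduct.map χ.toLinearMap (groupChar D' 1).toLinearMap z) := by
      intro z
      induction z with
      | zero => simp
      | add a b ha hb => simp only [map_add, mul_add, ha, hb]
      | tmul a b =>
        simp [skewDer_mul, χ, add_mul, groupChar_one]
        split_ifs <;> ring
    have h2 : ∀ z, LinearMap.mul' k k (TensorProduct.map (skewDer D' i) χ.toLinearMap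
        ((Boson.bE D' (TV D') j ⊗ₜ 1 + Boson.inG D' (TV D') (D'.grp j) ⊗ₜ Boson.bE D' (TV D') j) *
          z)) = (if i = j then -1 else 0 : k) * LinearMap.mul' k k
            (TensorProduct.map (groupChar D' 1).toLinearMap χ.toLinearMap z) := by
      intro z
      induction z with
      | zero => simp
      | add a b ha hb => simp only [map_add, mul_add, ha, hb]
      | tmul a b =>
        simp [skewDer_mul, χ, add_mul, groupChar_one]
    have h3 := congrArg (fun f => f.ofConv t) (groupChar_convMul D' (form g) 1)
    have h4 := congrArg (fun f => f.ofConv t) (groupChar_convMul D' 1 (form g))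
    simp only [LinearMap.comp_apply, LinearMap.smul_apply, Bialgebra.comul_mul, Boson.comul_bE,
      h1, h2]
    rw [mul_one (form g)] at h3
    rw [one_mul (form g)] at h4
    refine (congrArg _ h3).trans (Eq.trans ?_ (congrArg (fun c => (D.char i g : k) •
      ((if i = j then -1 else 0) * c)) h4.symm))
    by_cases hij : i = j
    · subst hij
      simp [h.char_left]
    · simp [hij]

variable {D D'} in
/-- The algebra map from the bosonization to the convolution algebra of linear forms on the dual
bosonization, with values `g ↦ groupChar (form g)` and `E i ↦ skewDer i`. -/
def toConvDual {form : Γ →* Λ →* kˣ} (h : IsDualPair D D' form) :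
    Boson D (TV D) →ₐ[k] WithConv (Boson D' (TV D') →ₗ[k] k) :=
  Boson.liftGen D (fun i => WithConv.toConv (skewDer D' i))
    { toFun := fun g => WithConv.toConv (groupChar D' (form g)).toLinearMap
      map_one' := by
        refine WithConv.ext (LinearMap.ext fun x => ?_)
        simp [LinearMap.convOne_def, groupChar_one]
      map_mul' := fun g g' => by rw [groupChar_convMul, map_mul] }
    fun g i => groupChar_convMul_skewDer h g i

variable {D D'} in
/-- The pairing of the bosonizations of the tensor algebras of two dual Yetter-Drinfeld modules. -/
def bosonForm {form : Γ →* Λ →* kˣ} (h : IsDualPair D D' form) :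
    Boson D (TV D) →ₗ[k] Boson D' (TV D') →ₗ[k] k :=
  (WithConv.linearEquiv k _).toLinearMap ∘ₗ (toConvDual h).toLinearMap

/-- The pairings of the bosonizations of the tensor algebras of two Yetter-Drinfeld modules with
the prescribed values on the generators. -/
structure IsBosonPairing (form : Γ →* Λ →* kˣ)
    (β : Boson D (TV D) →ₗ[k] Boson D' (TV D') →ₗ[k] k) : Prop extends IsBialgebraPairing β where
  group_group : ∀ x y, β (Boson.inG D (TV D) x) (Boson.inG D' (TV D') y) = form x y
  E_F : ∀ i j, β (Boson.bE D (TV D) i) (Boson.bE D' (TV D') j) = if i = j then -1 else 0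
  E_group : ∀ i y, β (Boson.bE D (TV D) i) (Boson.inG D' (TV D') y) = 0
  group_F : ∀ x j, β (Boson.inG D (TV D) x) (Boson.bE D' (TV D') j) = 0

variable {D D'} in
theorem bosonForm_isBosonPairing {form : Γ →* Λ →* kˣ} (h : IsDualPair D D' form) :
    IsBosonPairing D D' form (bosonForm h) := by
  have hG : ∀ g b, bosonForm h (Boson.inG D (TV D) g) b = groupChar D' (form g) b :=
    fun g b => by simp [bosonForm, toConvDual]
  have hE : ∀ i b, bosonForm h (Boson.bE D (TV D) i) b = skewDer D' i b :=
    fun i b => by simp [bosonForm, toConvDual]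
  have h1 : ∀ b, bosonForm h 1 b = Coalgebra.counit b := fun b => by
    rw [← map_one (Boson.inG D (TV D)), hG, map_one, groupChar_one]
  have hl : ∀ a a' b, bosonForm h (a * a') b = LinearMap.mul' k k
      (TensorProduct.map (bosonForm h a) (bosonForm h a') (Coalgebra.comul b)) :=
    fun a a' b => by simp [bosonForm]
  have hr : ∀ a b b', bosonForm h a (b * b') = LinearMap.mul' k k (TensorProduct.map
      ((bosonForm h).flip b) ((bosonForm h).flip b') (Coalgebra.comul a)) := by
    intro a
    have key := Boson.mem_of_gen (M := ⨅ b, ⨅ b', LinearMap.eqLocus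
      ((bosonForm h).flip (b * b')) (LinearMap.mul' k k ∘ₗ TensorProduct.map
        ((bosonForm h).flip b) ((bosonForm h).flip b') ∘ₗ Coalgebra.comul)) ?_ ?_ ?_ a
    · simpa [Submodule.mem_iInf, LinearMap.mem_eqLocus] using key
    · simp [Submodule.mem_iInf, LinearMap.mem_eqLocus, Algebra.TensorProduct.one_def, h1]
    · intro g t ht
      simp only [Submodule.mem_iInf, LinearMap.mem_eqLocus, LinearMap.comp_apply,
        LinearMap.flip_apply] at ht ⊢
      exact IsBialgebraPairing.mul_right_of_mul hl (fun b b' => by simp [hG]) ht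
    · intro i t ht
      simp only [Submodule.mem_iInf, LinearMap.mem_eqLocus, LinearMap.comp_apply,
        LinearMap.flip_apply] at ht ⊢
      refine IsBialgebraPairing.mul_right_of_mul hl (fun b b' => ?_) ht
      simp [hE, hG, h1, skewDer_mul, show D'.char i = form (D.grp i) from
        MonoidHom.ext (h.char_right i)]
  exact {
    one_left := h1
    one_right := LinearMap.congr_fun (f := (bosonForm h).flip 1) <| Boson.gen_induction
      (by simp [h1])
      (fun g t ht => by
        have ht : bosonForm h t 1 = Coalgebra.counit t := ht
        simp [hl, hG, ht, Algebra.TensorProduct.one_def])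
      (fun i t ht => by simp [hl, hE, Algebra.TensorProduct.one_def])
    mul_left := hl
    mul_right := hr
    group_group := by simp [hG]
    E_F := by simp [hE]
    E_group := by simp [hE]
    group_F := by simp [hG] }

variable {D D'} in
/-- A pairing of the bosonizations is determined by its values on the generators. -/
theorem IsBosonPairing.unique {form : Γ →* Λ →* kˣ}
    {β β' : Boson D (TV D) →ₗ[k] Boson D' (TV D') →ₗ[k] k}
    (hβ : IsBosonPairing D D' form β) (hβ' : IsBosonPairing D D' form β') : β = β' := by
  have hG : ∀ g, β (Boson.inG D (TV D) g) = β' (Boson.inG D (TV D) g) := by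
    intro g
    refine Boson.gen_induction ?_ ?_ ?_
    · rw [hβ.one_right, hβ'.one_right]
    · intro y t ht
      simp [hβ.mul_right, hβ'.mul_right, ht, hβ.group_group, hβ'.group_group]
    · intro j t ht
      simp [hβ.mul_right, hβ'.mul_right, hβ.group_F, hβ'.group_F]
  have hE : ∀ i, β (Boson.bE D (TV D) i) = β' (Boson.bE D (TV D) i) := by
    intro i
    refine Boson.gen_induction ?_ ?_ ?_
    · rw [hβ.one_right, hβ'.one_right]
    · intro y t ht
      simp [hβ.mul_right, hβ'.mul_right, ht, hG, hβ.E_group, hβ'.E_group, hβ'.group_group]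
    · intro j t ht
      simp [hβ.mul_right, hβ'.mul_right, hβ.one_left, hβ'.one_left, hβ.E_F, hβ'.E_F, hβ.group_F,
        hβ'.group_F]
  refine Boson.gen_induction ?_ ?_ ?_
  · ext b
    rw [hβ.one_left, hβ'.one_left]
  · intro g t ht
    ext b
    rw [hβ.mul_left, hβ'.mul_left, ht, hG]
  · intro i t ht
    ext b
    rw [hβ.mul_left, hβ'.mul_left, ht, hE]

end Convolution

end

/-! ### The induced form on the tensor algebras -/

section

variable {Γ Λ ι : Type*} [CommGroup Γ] [CommGroup Λ]

section translate

variable (D : DiagonalYD k Γ ι)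

/-- The algebra endomorphism `x ↦ x₍₁₎ χ(x₍₂₎)` of `T(V) # k[Γ]`, where the character `χ` of `Γ` is
extended by zero on `V`. It fixes `T(V)` and multiplies `g` by `χ g`. -/
def translate (χ : Γ →* kˣ) : Boson D (TV D) →ₐ[k] Boson D (TV D) :=
  (Algebra.TensorProduct.rid k k _).toAlgHom.comp
    ((Algebra.TensorProduct.map (AlgHom.id k _) (groupChar D χ)).comp (Boson.comulB D (TV D)))

theorem translate_inG (χ : Γ →* kˣ) (g : Γ) :
    translate D χ (Boson.inG D (TV D) g) = (χ g : k) • Boson.inG D (TV D) g := by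
  simp [translate]

theorem translate_inR (χ : Γ →* kˣ) (t : TV D) :
    translate D χ (Boson.inR D (TV D) t) = Boson.inR D (TV D) t := by
  have : (translate D χ).comp (Boson.inR D (TV D)) = Boson.inR D (TV D) :=
    TV_hom_ext fun i => by
      simp [translate, ← Boson.bE_TV]
  exact congrArg (fun f => f t) this

end translate

variable {D : DiagonalYD k Γ ι} {D' : DiagonalYD k Λ ι} {form : Γ →* Λ →* kˣ}
  {β : Boson D (TV D) →ₗ[k] Boson D' (TV D') →ₗ[k] k}

open Boson

namespace IsBosonPairing

variable [DecidableEq ι]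

protected theorem flip (hβ : IsBosonPairing D D' form β) :
    IsBosonPairing D' D form.flip β.flip where
  toIsBialgebraPairing := hβ.toIsBialgebraPairing.flip
  group_group y x := hβ.group_group x y
  E_F i j := by simp [hβ.E_F, eq_comm]
  E_group i x := hβ.group_F x i
  group_F y j := hβ.E_group j y

theorem inG_apply (hβ : IsBosonPairing D D' form β) (x : Γ) (b : Boson D' (TV D')) :
    β (inG D (TV D) x) b = groupChar D' (form x) b := by
  refine LinearMap.congr_fun (f := β (inG D (TV D) x)) (g := (groupChar D' (form x)).toLinearMap)
    (gen_induction ?_ ?_ ?_) b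
  · simp [hβ.one_right]
  · intro y t ht
    simp [hβ.mul_right, hβ.group_group, ht]
  · intro y t ht
    simp [hβ.mul_right, hβ.group_F]

theorem mul_inG_left (hβ : IsBosonPairing D D' form β) (a : Boson D (TV D)) (x : Γ)
    (b : Boson D' (TV D')) : β (a * inG D (TV D) x) b = β a (translate D' (form x) b) := by
  rw [hβ.mul_left]
  have h1 : ∀ z, LinearMap.mul' k k (TensorProduct.map (β a) (β (inG D (TV D) x)) z) =
      β a (Algebra.TensorProduct.rid k k _
        (Algebra.TensorProduct.map (AlgHom.id k _) (groupChar D' (form x)) z)) := by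
    intro z
    induction z with
    | zero => simp
    | add a b ha hb => simp only [map_add, ha, hb]
    | tmul a b => simp [hβ.inG_apply, mul_comm]
  exact h1 _

theorem mul_inG_right (hβ : IsBosonPairing D D' form β) (a : Boson D (TV D)) (y : Λ)
    (b : Boson D' (TV D')) : β a (b * inG D' (TV D') y) = β (translate D (form.flip y) a) b :=
  hβ.flip.mul_inG_left b y a

/-- The pairing is determined by its restrictions to the tensor algebras and to the groups. -/
theorem mul_mul (hβ : IsBosonPairing D D' form β) (s : TV D) (t : TV D') (x : Γ) (y : Λ) :
    β (inR D _ s * inG D _ x) (inR D' _ t * inG D' _ y) = β (inR D _ s) (inR D' _ t) * form x y := by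
  rw [hβ.mul_inG_left, map_mul, translate_inR, translate_inG, mul_smul_comm, map_smul,
    hβ.mul_inG_right, translate_inR, smul_eq_mul, mul_comm]

end IsBosonPairing

variable (β) in
/-- The restriction of a bilinear form on the bosonizations to the tensor algebras. -/
def tensorForm : TV D →ₗ[k] TV D' →ₗ[k] k :=
  β.compl₁₂ (inR D (TV D)).toLinearMap (inR D' (TV D')).toLinearMap

theorem tensorForm_apply (s : TV D) (t : TV D') :
    tensorForm β s t = β (inR D (TV D) s) (inR D' (TV D') t) := rfl

/-! ### Words -/

section word

variable (D)

theorem braidedComul_E (i : ι) : braidedComul D (E D i) = E D i ⊗ₜ 1 + 1 ⊗ₜ E D i := by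
  have := braidedComul_E_mul D i 1
  rwa [mul_one, braidedComul_one, braidedMulLeft_tmul, mul_one, smul_one] at this

/-- The product of the `E i` along a list. -/
def word (l : List ι) : TV D := (l.map (E D)).prod

@[simp] theorem word_nil : word D [] = 1 := rfl

@[simp] theorem word_cons (i : ι) (l : List ι) : word D (i :: l) = E D i * word D l := by
  simp [word]

/-- The span of the words in which each letter occurs as often as in the multiset `α`. -/
def content (α : Multiset ι) : Submodule k (TV D) :=
  Submodule.span k (word D '' {l | (l : Multiset ι) = α})

theorem word_mem_content (l : List ι) : word D l ∈ content D (l : Multiset ι) :=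
  Submodule.subset_span ⟨l, rfl, rfl⟩

theorem iSup_content : ⨆ α, content D α = ⊤ := by
  refine eq_top_iff.2 fun t _ => ?_
  have h1 : ∀ t : TV D, t ∈ Submodule.span k (Set.range (word D)) := by
    refine TV_mem (Submodule.subset_span ⟨[], rfl⟩) fun i t ht => ?_
    have : Submodule.span k (Set.range (word D)) ≤
        (Submodule.span k (Set.range (word D))).comap (LinearMap.mulLeft k (E D i)) := by
      rw [Submodule.span_le]
      rintro _ ⟨l, rfl⟩
      exact Submodule.subset_span ⟨i :: l, by simp⟩
    exact this ht
  have h2 : Submodule.span k (Set.range (word D)) ≤ ⨆ α, content D α := by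
    rw [Submodule.span_le]
    rintro _ ⟨l, rfl⟩
    exact Submodule.mem_iSup_of_mem _ (word_mem_content D l)
  exact h2 (h1 t)

variable {D} in
theorem word_ext {M : Type*} [AddCommGroup M] [Module k M] {f f' : TV D →ₗ[k] M}
    (h : ∀ l, f (word D l) = f' (word D l)) : f = f' := by
  have : ⨆ α, content D α ≤ LinearMap.eqLocus f f' := by
    refine iSup_le fun α => ?_
    rw [content, Submodule.span_le]
    rintro _ ⟨l, _, rfl⟩
    exact h l
  exact LinearMap.ext fun x => this (iSup_content D ▸ Submodule.mem_top)

theorem smul_word (g : Γ) (l : List ι) :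
    g • word D l = ((l.map fun i => (D.char i g : k)).prod) • word D l := by
  induction l with
  | nil => simp
  | cons i l ih =>
    rw [word_cons, smul_mul', ih, smul_E, smul_mul_smul_comm]
    simp

theorem coact_word (l : List ι) :
    coact D (word D l) = MonoidAlgebra.of k Γ (l.map D.grp).prod ⊗ₜ word D l := by
  induction l with
  | nil => simp [Algebra.TensorProduct.one_def, MonoidAlgebra.one_def]
  | cons i l ih =>
    rw [word_cons, map_mul, ih, coact, liftE_E, Algebra.TensorProduct.tmul_mul_tmul, ← map_mul]
    simp

theorem coactB_word (l : List ι) :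
    coactB D (TV D) (word D l) = inG D (TV D) (l.map D.grp).prod ⊗ₜ inR D (TV D) (word D l) := by
  induction l with
  | nil => simp [Algebra.TensorProduct.one_def]
  | cons i l ih =>
    have h : coactB D (TV D) (E D i) = inG D (TV D) (D.grp i) ⊗ₜ inR D (TV D) (E D i) :=
      coactB_proj_E D (TV D) i
    rw [word_cons, map_mul, ih, h, Algebra.TensorProduct.tmul_mul_tmul, ← map_mul, ← map_mul]
    simp

theorem tcounit_word {l : List ι} (hl : l ≠ []) : tcounit D (word D l) = 0 := by
  cases l with
  | nil => exact absurd rfl hl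
  | cons i l => simp [tcounit]

theorem word_mem_homog (l : List ι) : word D l ∈ homog D l.length := by
  induction l with
  | nil => exact Submodule.one_le.1 le_rfl
  | cons i l ih =>
    rw [word_cons, List.length_cons, homog, pow_succ']
    exact Submodule.mul_mem_mul ⟨_, rfl⟩ ih

theorem content_le_homog (α : Multiset ι) : content D α ≤ homog D (Multiset.card α) := by
  refine Submodule.span_le.2 ?_
  rintro _ ⟨l, rfl, rfl⟩
  exact word_mem_homog D l

/-- The braided coproduct of a word is a combination of tensor products of two complementary
words. -/
theorem braidedComul_word_mem (l : List ι) : braidedComul D (word D l) ∈ Submodule.span k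
    {z | ∃ a b : List ι, (a ++ b).Perm l ∧ z = word D a ⊗ₜ[k] word D b} := by
  induction l with
  | nil => exact Submodule.subset_span ⟨[], [], List.Perm.refl _, braidedComul_one D⟩
  | cons i l ih =>
    rw [word_cons, braidedComul_E_mul]
    refine Submodule.span_induction (p := fun z _ => braidedMulLeft D i z ∈ Submodule.span k _)
      ?_ (by simp) (fun x y _ _ hx hy => by simpa using add_mem hx hy)
      (fun c x _ hx => by simpa using Submodule.smul_mem _ c hx) ih
    rintro _ ⟨a, b, hab, rfl⟩
    rw [braidedMulLeft_tmul, smul_word, ← TensorProduct.smul_tmul', ← word_cons, ← word_cons]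
    refine add_mem (Submodule.subset_span ⟨i :: a, b, hab.cons i, rfl⟩)
      (Submodule.smul_mem _ _ (Submodule.subset_span ⟨a, i :: b, ?_, rfl⟩))
    exact List.perm_middle.trans (hab.cons i)

end word

namespace IsBosonPairing

variable [DecidableEq ι] (hβ : IsBosonPairing D D' form β)

include hβ

theorem tensorForm_one (t : TV D') : tensorForm β 1 t = tcounit D' t := by
  rw [tensorForm_apply, map_one, hβ.one_left]
  change counitB D' (TV D') _ = _
  rw [counitB, lift_inR]
  exact descend_apply (BraidedQuotient.proj (D := D')) BraidedQuotient.surj (tcounit D') _ t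

theorem tensorForm_E_E (i j : ι) : tensorForm β (E D i) (E D' j) = if i = j then -1 else 0 :=
  hβ.E_F i j

/-- On the tensor algebras, the multiplication of one side is dual to the braided comultiplication
of the other. -/
theorem tensorForm_mul (x y : TV D) (t : TV D') : tensorForm β (x * y) t =
    LinearMap.mul' k k (TensorProduct.map (tensorForm β x) (tensorForm β y) (braidedComul D' t)) := by
  have hcomul : Coalgebra.comul (R := k) (inR D' (TV D') t) =
      kappa D' (TV D') (braidedComul D' t) := by
    have h1 : Coalgebra.comul (R := k) (inR D' (TV D') t) = comulR D' (TV D') t := by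
      change comulB D' (TV D') _ = _
      rw [comulB, lift_inR]
    have h2 : TensorProduct.map (BraidedQuotient.proj (D := D') (R := TV D')).toLinearMap
      (BraidedQuotient.proj (D := D') (R := TV D')).toLinearMap = LinearMap.id :=
      TensorProduct.map_id
    have h3 := comulT_eq D' (TV D') t
    rw [h2] at h3
    exact h1.trans ((comulR_proj D' (TV D') t).trans h3)
  rw [tensorForm_apply, map_mul, hβ.mul_left, hcomul]
  -- The group elements in `r s₍₋₁₎ ⊗ s₍₀₎` do not contribute, as `β(x, r g) = β(x, r)` on `T(V)`.
  have key : LinearMap.mul' k k ∘ₗ TensorProduct.map (β (inR D (TV D) x)) (β (inR D (TV D) y)) ∘ₗ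
      kappa D' (TV D') = LinearMap.mul' k k ∘ₗ
        TensorProduct.map (tensorForm β x) (tensorForm β y) := by
    refine TensorProduct.ext ?_
    refine LinearMap.ext fun r => word_ext fun l => ?_
    change LinearMap.mul' k k (TensorProduct.map _ _ (kappa D' (TV D') (r ⊗ₜ word D' l))) =
      LinearMap.mul' k k (TensorProduct.map _ _ (r ⊗ₜ word D' l))
    simp only [kappa_tmul, coactB_word, Algebra.TensorProduct.tmul_mul_tmul, one_mul, TensorProduct.map_tmul,
      hβ.mul_inG_right, translate_inR, tensorForm_apply, LinearMap.mul'_apply]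
  exact LinearMap.congr_fun key _

theorem tensorForm_one_right (s : TV D) : tensorForm β s 1 = tcounit D s :=
  hβ.flip.tensorForm_one s

theorem tensorForm_mul_right (s : TV D) (x y : TV D') : tensorForm β s (x * y) =
    LinearMap.mul' k k (TensorProduct.map ((tensorForm β).flip x) ((tensorForm β).flip y)
      (braidedComul D s)) :=
  hβ.flip.tensorForm_mul x y s

theorem tensorForm_E_word {i : ι} {l : List ι} (h : l ≠ [i]) :
    tensorForm β (E D i) (word D' l) = 0 := by
  have hc : ∀ i, tcounit D (E D i) = 0 := fun i => by simp [tcounit]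
  have hc' : ∀ i, tcounit D' (E D' i) = 0 := fun i => by simp [tcounit]
  cases l with
  | nil => rw [word_nil, hβ.tensorForm_one_right, hc]
  | cons j l =>
    rw [word_cons, hβ.tensorForm_mul_right, braidedComul_E]
    by_cases hl : l = []
    · subst hl
      have : i ≠ j := fun hij => h (by rw [hij])
      simp [hβ.tensorForm_E_E, hβ.tensorForm_one, hc', this]
    · simp [hβ.tensorForm_one, hc', tcounit_word D' hl]

/-- The form is homogeneous with respect to the content of words. -/
theorem tensorForm_word_word {l l' : List ι} (h : ¬ l.Perm l') :
    tensorForm β (word D l) (word D' l') = 0 := by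
  induction l generalizing l' with
  | nil =>
    rw [word_nil, hβ.tensorForm_one, tcounit_word]
    rintro rfl
    exact h (List.Perm.refl _)
  | cons i l ih =>
    rw [word_cons, hβ.tensorForm_mul]
    refine (show Submodule.span k _ ≤ LinearMap.ker (LinearMap.mul' k k ∘ₗ TensorProduct.map
      (tensorForm β (E D i)) (tensorForm β (word D l))) from Submodule.span_le.2 ?_)
        (braidedComul_word_mem D' l')
    rintro _ ⟨a, b, hab, rfl⟩
    simp only [SetLike.mem_coe, LinearMap.mem_ker, LinearMap.comp_apply, TensorProduct.map_tmul,
      LinearMap.mul'_apply]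
    -- Only the terms whose first factor is the letter `i` survive.
    by_cases ha : a = [i]
    · have hlb : ¬ l.Perm b := fun hlb => h ((hlb.cons i).trans (by rwa [ha] at hab))
      rw [ih hlb, mul_zero]
    · rw [hβ.tensorForm_E_word ha, zero_mul]

end IsBosonPairing

end

/-! ### The radical of the form on the tensor algebras -/

/-- Over a field, the left radical of `b ⊗ b` is generated by the left radical of `b`. -/
theorem mem_map₂_ker_of_forall {M N : Type*} [AddCommGroup M] [AddCommGroup N] [Module k M]
    [Module k N] (b : M →ₗ[k] N →ₗ[k] k) {z : M ⊗[k] M}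
    (hz : ∀ x y, LinearMap.mul' k k (TensorProduct.map (b.flip x) (b.flip y) z) = 0) :
    z ∈ Submodule.map₂ (TensorProduct.mk k M M) (LinearMap.ker b) ⊤ ⊔
      Submodule.map₂ (TensorProduct.mk k M M) ⊤ (LinearMap.ker b) := by
  let q := (LinearMap.ker b).mkQ
  let c : (M ⧸ LinearMap.ker b) →ₗ[k] N →ₗ[k] k := (LinearMap.ker b).liftQ b le_rfl
  have hc : ∀ u, (∀ x, c u x = 0) → u = 0 := fun u hu =>
    LinearMap.ker_eq_bot'.1 (Submodule.ker_liftQ_eq_bot' _ b rfl) u (LinearMap.ext hu)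
  have hcq : ∀ x, c.flip x ∘ₗ q = b.flip x := fun x => LinearMap.ext fun m => rfl
  -- Expanding along a basis of the second factor, the coefficients vanish since the form is
  -- separating on the quotient by its radical.
  have hq : TensorProduct.map q q z = 0 := by
    have h0 : ∀ x y, LinearMap.mul' k k (TensorProduct.map (c.flip x) (c.flip y)
        (TensorProduct.map q q z)) = 0 := fun x y => by
      rw [mul'_map_map, hcq, hcq, hz]
    let 𝒞 := Module.Basis.ofVectorSpace k (M ⧸ LinearMap.ker b)
    obtain ⟨w, hw⟩ := TensorProduct.eq_repr_basis_right 𝒞 (TensorProduct.map q q z)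
    rw [← hw] at h0 ⊢
    have h1 : ∀ x i, c (w i) x = 0 := by
      intro x
      have h2 : w.sum (fun i m => c m x • 𝒞 i) = 0 := hc _ fun y => by
        simpa [Finsupp.sum] using h0 x y
      have h3 := linearIndependent_iff'.1 𝒞.linearIndependent _ _ h2
      intro i
      by_cases hi : i ∈ w.support
      · exact h3 i hi
      · simp [Finsupp.notMem_support_iff.1 hi]
    exact Finset.sum_eq_zero fun i _ => by
      simp [hc (w i) fun x => h1 x i]
  have hexact : Function.Exact (LinearMap.ker b).subtype q := LinearMap.exact_subtype_mkQ _
  have h4 := TensorProduct.map_ker hexact (Submodule.mkQ_surjective _) hexact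
    (Submodule.mkQ_surjective _)
  have h5 : z ∈ LinearMap.ker (TensorProduct.map q q) := hq
  rw [h4] at h5
  refine SetLike.le_def.1 (sup_le ?_ ?_) h5
  · refine le_sup_of_le_right ?_
    rintro _ ⟨w, rfl⟩
    induction w with
    | zero => simp
    | add u v hu hv => rw [map_add]; exact add_mem hu hv
    | tmul u v => exact Submodule.apply_mem_map₂ _ Submodule.mem_top v.2
  · refine le_sup_of_le_left ?_
    rintro _ ⟨w, rfl⟩
    induction w with
    | zero => simp
    | add u v hu hv => rw [map_add]; exact add_mem hu hv
    | tmul u v => exact Submodule.apply_mem_map₂ _ u.2 Submodule.mem_top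

section

variable {Γ Λ ι : Type*} [CommGroup Γ] [CommGroup Λ] [DecidableEq ι]

variable {D : DiagonalYD k Γ ι} {D' : DiagonalYD k Λ ι} {form : Γ →* Λ →* kˣ}
  {β : Boson D (TV D) →ₗ[k] Boson D' (TV D') →ₗ[k] k}

open Boson

namespace IsBosonPairing

variable (hβ : IsBosonPairing D D' form β)

/-- The left radical of the form on the tensor algebras. -/
def radical : Ideal (TV D) where
  carrier := {x | tensorForm β x = 0}
  add_mem' {x y} hx hy := by
    change tensorForm β _ = 0
    rw [map_add, hx, hy, add_zero]
  zero_mem' := map_zero _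
  smul_mem' c x hx := by
    have hx : tensorForm β x = 0 := hx
    refine LinearMap.ext fun t => ?_
    rw [smul_eq_mul, hβ.tensorForm_mul, hx]
    simp

theorem mem_radical {x : TV D} : x ∈ radical hβ ↔ tensorForm β x = 0 := Iff.rfl

include hβ in
theorem tensorForm_content {α : Multiset ι} {x : TV D} (hx : x ∈ content D α) {l : List ι}
    (hl : (l : Multiset ι) ≠ α) : tensorForm β x (word D' l) = 0 := by
  refine (show content D α ≤ LinearMap.ker ((tensorForm β).flip (word D' l)) from
    Submodule.span_le.2 ?_) hx
  rintro _ ⟨m, rfl, rfl⟩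
  exact hβ.tensorForm_word_word fun h => hl (Multiset.coe_eq_coe.2 h.symm)

/-- The components of an element of the radical lie in the radical. -/
theorem radical_eq_iSup : (radical hβ).restrictScalars k =
    ⨆ α, (radical hβ).restrictScalars k ⊓ content D α := by
  refine le_antisymm (fun x hx => ?_) (iSup_le fun α => inf_le_left)
  obtain ⟨f, hf, rfl⟩ := (Submodule.mem_iSup_iff_exists_finsupp _ _).1
    (iSup_content D ▸ Submodule.mem_top : x ∈ ⨆ α, content D α)
  have hx : tensorForm β (f.sum fun _ x => x) = 0 := hx
  refine Submodule.sum_mem _ fun α _ => Submodule.mem_iSup_of_mem α ⟨?_, hf α⟩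
  refine word_ext fun l => ?_
  by_cases hl : (l : Multiset ι) = α
  · have h1 := LinearMap.congr_fun hx (word D' l)
    rw [Finsupp.sum, map_sum, LinearMap.sum_apply, Finset.sum_eq_single α] at h1
    · exact h1
    · intro γ _ hγ
      exact hβ.tensorForm_content (hf γ) (by rw [hl]; exact hγ.symm)
    · intro hα
      rw [Finsupp.notMem_support_iff.1 hα, map_zero, LinearMap.zero_apply]
  · exact hβ.tensorForm_content (hf α) hl

/-- The radical contains no elements of degree less than two, as the form is non-degenerate in
degrees zero and one. -/
theorem radical_inf_content_eq_bot {α : Multiset ι} (hα : Multiset.card α < 2) :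
    (radical hβ).restrictScalars k ⊓ content D α = ⊥ := by
  refine (Submodule.eq_bot_iff _).2 ?_
  rintro x ⟨hx, hxα⟩
  have hx : tensorForm β x = 0 := hx
  obtain h | h : Multiset.card α = 0 ∨ Multiset.card α = 1 := by omega
  · rw [Multiset.card_eq_zero] at h
    have h1 : {l : List ι | (l : Multiset ι) = 0} = {[]} := by ext; simp
    rw [content, h, h1, Set.image_singleton, SetLike.mem_coe, Submodule.mem_span_singleton] at hxα
    obtain ⟨c, rfl⟩ := hxα
    have h2 := LinearMap.congr_fun hx 1
    rw [map_smul, LinearMap.smul_apply, word_nil, hβ.tensorForm_one, map_one] at h2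
    have : c = 0 := by simpa using h2
    rw [this, zero_smul]
  · obtain ⟨i, rfl⟩ := Multiset.card_eq_one.1 h
    have h1 : {l : List ι | (l : Multiset ι) = {i}} = {[i]} := by ext; simp
    rw [content, h1, Set.image_singleton, SetLike.mem_coe, Submodule.mem_span_singleton] at hxα
    obtain ⟨c, rfl⟩ := hxα
    have h2 := LinearMap.congr_fun hx (E D' i)
    rw [map_smul, LinearMap.smul_apply, word_cons, word_nil, mul_one, hβ.tensorForm_E_E] at h2
    have : c = 0 := by simpa using h2
    rw [this, zero_smul]

theorem radical_induction {M : Submodule k (TV D)}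
    (h : ∀ α, (radical hβ).restrictScalars k ⊓ content D α ≤ M) {x : TV D}
    (hx : x ∈ radical hβ) : x ∈ M := by
  have hx : x ∈ (radical hβ).restrictScalars k := hx
  rw [radical_eq_iSup] at hx
  exact iSup_le h hx

/-- The radical is one of the ideals whose sum is the defining ideal of the Nichols algebra. -/
theorem radical_isNicholsCandidate : IsNicholsCandidate D (radical hβ) where
  twoSided := ⟨fun {a} b ha => by
    have ha : tensorForm β a = 0 := ha
    refine LinearMap.ext fun t => ?_
    rw [hβ.tensorForm_mul, ha]
    simp⟩
  graded := by
    rw [radical_eq_iSup]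
    refine iSup_le fun α => ?_
    by_cases hα : 2 ≤ Multiset.card α
    · rw [← radical_eq_iSup]
      exact le_iSup₂_of_le _ hα (inf_le_inf_left _ (content_le_homog D α))
    · rw [radical_inf_content_eq_bot hβ (not_le.1 hα)]
      exact bot_le
  act_mem g x hx := by
    refine radical_induction hβ (M := ((radical hβ).restrictScalars k).comap
      (act D g).toLinearMap) ?_ hx
    rintro α x ⟨hx, hxα⟩
    have h1 : content D α ≤ LinearMap.eqLocus (act D g).toLinearMap
        ((α.map fun i => (D.char i g : k)).prod • LinearMap.id) := by
      refine Submodule.span_le.2 ?_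
      rintro _ ⟨l, rfl, rfl⟩
      simpa [← act_def] using smul_word D g l
    have h2 : act D g x = (α.map fun i => (D.char i g : k)).prod • x := h1 hxα
    change act D g x ∈ (radical hβ).restrictScalars k
    rw [h2]
    exact Submodule.smul_mem _ _ hx
  coact_mem x hx := by
    refine radical_induction hβ (M := (Submodule.map₂ (TensorProduct.mk k (MonoidAlgebra k Γ)
      (TV D)) ⊤ ((radical hβ).restrictScalars k)).comap (coact D).toLinearMap) ?_ hx
    rintro α x ⟨hx, hxα⟩
    have h1 : content D α ≤ LinearMap.eqLocus (coact D).toLinearMap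
        (TensorProduct.mk k _ _ (MonoidAlgebra.of k Γ (α.map D.grp).prod)) := by
      refine Submodule.span_le.2 ?_
      rintro _ ⟨l, rfl, rfl⟩
      simpa using coact_word D l
    have h2 : coact D x = MonoidAlgebra.of k Γ (α.map D.grp).prod ⊗ₜ x := h1 hxα
    rw [Submodule.mem_comap, AlgHom.toLinearMap_apply, h2]
    exact Submodule.apply_mem_map₂ _ Submodule.mem_top hx
  coideal x hx := by
    refine mem_map₂_ker_of_forall (tensorForm β) fun s t => ?_
    have hx : tensorForm β x = 0 := hx
    rw [← hβ.tensorForm_mul_right, hx, LinearMap.zero_apply]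

/-- The form vanishes on the defining ideal of the Nichols algebra: this is proved by induction on
the degree in the second variable, using that the ideal is a coideal in degrees at least two. -/
theorem nicholsIdeal_le_radical : nicholsIdeal D ≤ radical hβ := by
  have hI := nicholsIdeal_isNicholsCandidate D
  have hE : ∀ i, ∀ x ∈ nicholsIdeal D, tensorForm β x (E D' i) = 0 := by
    intro i x hx
    -- `E i` is primitive, so it pairs to zero with products of elements of positive degree.
    have h1 : ∀ n, 2 ≤ n → homog D n ≤ LinearMap.ker ((tensorForm β).flip (E D' i)) := by
      intro n hn
      obtain ⟨m, rfl⟩ := Nat.exists_eq_add_of_le' hn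
      rw [homog, pow_succ, Submodule.mul_le]
      intro a ha b hb
      have ha : tcounit D a = 0 := homog_tcounit D (Nat.le_add_left 1 m) ha
      have hb : tcounit D b = 0 := homog_tcounit D le_rfl (by rwa [homog, pow_one])
      rw [LinearMap.mem_ker, LinearMap.flip_apply, hβ.tensorForm_mul, braidedComul_E]
      simp [hβ.tensorForm_one_right, ha, hb]
    exact (iSup₂_le fun n hn => inf_le_right.trans (h1 n hn)) (hI.graded hx)
  intro x hx
  refine LinearMap.ext fun t => ?_
  have key := TV_mem (D := D') (M := ⨅ x : nicholsIdeal D, LinearMap.ker (tensorForm β x))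
    ?_ ?_ t
  · exact (Submodule.mem_iInf _).1 key ⟨x, hx⟩
  · refine (Submodule.mem_iInf _).2 fun y => ?_
    rw [LinearMap.mem_ker, hβ.tensorForm_one_right]
    exact BraidedQuotient.counit_ker (R := Nichols D) _ ((toNichols_eq_zero D).2 y.2)
  · intro i t ht
    rw [Submodule.mem_iInf] at ht
    refine (Submodule.mem_iInf _).2 fun y => ?_
    rw [LinearMap.mem_ker, hβ.tensorForm_mul_right]
    refine (show _ ≤ LinearMap.ker (LinearMap.mul' k k ∘ₗ TensorProduct.map
      ((tensorForm β).flip (E D' i)) ((tensorForm β).flip t)) from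
        sup_le (Submodule.map₂_le.2 ?_) (Submodule.map₂_le.2 ?_)) (hI.coideal _ y.2)
    · intro a ha b _
      simp [hE i a ha]
    · intro a _ b hb
      have : tensorForm β b t = 0 := ht ⟨b, hb⟩
      simp [this]

/-- The Nichols algebra is the quotient of the tensor algebra by the radical of the form. -/
theorem nicholsIdeal_eq_radical : nicholsIdeal D = radical hβ :=
  le_antisymm (nicholsIdeal_le_radical hβ) (radical_isNicholsCandidate hβ).le

include hβ in
theorem tensorForm_eq_zero {x : TV D} : tensorForm β x = 0 ↔ x ∈ nicholsIdeal D := by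
  rw [nicholsIdeal_eq_radical hβ, mem_radical]

end IsBosonPairing

end

/-! ### The pairing of the bosonizations of the Nichols algebras -/

/-- A bilinear form descends along surjections whose kernels lie in its radicals. -/
theorem exists_descend_bilinear {A H A' H' : Type*} [AddCommGroup A] [AddCommGroup H]
    [AddCommGroup A'] [AddCommGroup H'] [Module k A] [Module k H] [Module k A'] [Module k H']
    (β : A →ₗ[k] H →ₗ[k] k) {p : A →ₗ[k] A'} {q : H →ₗ[k] H'} (hp : Function.Surjective p)
    (hq : Function.Surjective q) (hpβ : ∀ a, p a = 0 → β a = 0)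
    (hqβ : ∀ b, q b = 0 → β.flip b = 0) :
    ∃ ν : A' →ₗ[k] H' →ₗ[k] k, ∀ a b, ν (p a) (q b) = β a b := by
  obtain ⟨s, hs⟩ := p.exists_rightInverse_of_surjective (LinearMap.range_eq_top.2 hp)
  obtain ⟨t, ht⟩ := q.exists_rightInverse_of_surjective (LinearMap.range_eq_top.2 hq)
  refine ⟨β.compl₁₂ s t, fun a b => ?_⟩
  have hs : ∀ a, p (s a) = a := LinearMap.congr_fun hs
  have ht : ∀ b, q (t b) = b := LinearMap.congr_fun ht
  have h1 : β (s (p a)) = β a := sub_eq_zero.1 <| by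
    rw [← map_sub]
    exact hpβ _ (by rw [map_sub, hs, sub_self])
  have h2 : β.flip (t (q b)) = β.flip b := sub_eq_zero.1 <| by
    rw [← map_sub]
    exact hqβ _ (by rw [map_sub, ht, sub_self])
  rw [LinearMap.compl₁₂_apply, h1]
  exact LinearMap.congr_fun h2 a

/-- The algebra map to the convolution algebra of linear forms that is given by a pairing. -/
def IsBialgebraPairing.toConvAlgHom {A H : Type*} [Ring A] [Ring H] [Bialgebra k A]
    [Bialgebra k H] {β : A →ₗ[k] H →ₗ[k] k} (hβ : IsBialgebraPairing β) :
    A →ₐ[k] WithConv (H →ₗ[k] k) :=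
  AlgHom.ofLinearMap ((WithConv.linearEquiv k (H →ₗ[k] k)).symm.toLinearMap ∘ₗ β)
    (WithConv.ext (LinearMap.ext hβ.one_left))
    (fun a a' => WithConv.ext (LinearMap.ext (hβ.mul_left a a')))

section

variable {Γ Λ ι : Type*} [CommGroup Γ] [CommGroup Λ]

namespace Boson

theorem canonical_surjective (D : DiagonalYD k Γ ι) (R : Type*) [Ring R] [Algebra k R]
    [MulSemiringAction Γ R] [SMulCommClass Γ k R] [BraidedQuotient D R] :
    Function.Surjective (canonical D R) := by
  intro x
  refine mem_of_inR_mul_inG (M := LinearMap.range (canonicalAlgHom D R).toLinearMap)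
    (fun r g => ?_) x
  obtain ⟨t, rfl⟩ := BraidedQuotient.surj (D := D) r
  exact ⟨inR D (TV D) t * inG D (TV D) g, by simp⟩

theorem canonical_inR (D : DiagonalYD k Γ ι) (R : Type*) [Ring R] [Algebra k R]
    [MulSemiringAction Γ R] [SMulCommClass Γ k R] [BraidedQuotient D R] (t : TV D) :
    canonical D R (inR D (TV D) t) = inR D R (BraidedQuotient.proj t) :=
  canonicalAlgHom_inR D R t

theorem canonical_inG (D : DiagonalYD k Γ ι) (R : Type*) [Ring R] [Algebra k R]
    [MulSemiringAction Γ R] [SMulCommClass Γ k R] [BraidedQuotient D R] (g : Γ) :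
    canonical D R (inG D (TV D) g) = inG D R g :=
  canonicalAlgHom_inG D R g

/-- Every element of the smash product is a sum of elements `r g # g` over a finite set of
elements `g` of the group. -/
theorem exists_eq_sum {D : DiagonalYD k Γ ι} {R : Type*} [Ring R] [Algebra k R]
    [MulSemiringAction Γ R] [SMulCommClass Γ k R] [BraidedQuotient D R] (x : Boson D R) :
    ∃ (S : Finset Γ) (r : Γ → R), x = ∑ g ∈ S, inR D R (r g) * inG D R g := by
  let y : SkewMonoidAlgebra R Γ := x
  refine ⟨y.support, y.coeff, ?_⟩
  have h1 : ∀ g r, (inR D R r * inG D R g : Boson D R) = SkewMonoidAlgebra.single g r := by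
    intro g r
    have : (SkewMonoidAlgebra.single 1 r * SkewMonoidAlgebra.single g 1 :
        SkewMonoidAlgebra R Γ) = SkewMonoidAlgebra.single g r := by
      simp [SkewMonoidAlgebra.single_mul_single]
    exact this
  simp only [h1]
  exact (SkewMonoidAlgebra.sum_single y).symm

theorem inG_injective (D : DiagonalYD k Γ ι) (R : Type*) [Ring R] [Algebra k R]
    [MulSemiringAction Γ R] [SMulCommClass Γ k R] [BraidedQuotient D R] [Nontrivial R] :
    Function.Injective (inG D R) :=
  SkewMonoidAlgebra.of_injective R Γ

end Boson

instance (D : DiagonalYD k Γ ι) : Nontrivial (Nichols D) := by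
  refine ⟨1, 0, fun h => ?_⟩
  have h1 := BraidedQuotient.counit_ker (D := D) (R := Nichols D) 1 ((map_one (toNichols D)).trans h)
  simp at h1

variable [DecidableEq ι]

variable {D : DiagonalYD k Γ ι} {D' : DiagonalYD k Λ ι} {form : Γ →* Λ →* kˣ}
  {β : Boson D (TV D) →ₗ[k] Boson D' (TV D') →ₗ[k] k}

open Boson

namespace IsBosonPairing

/-- The algebra map to the convolution algebra that is given by the pairing kills `I(V)`, hence
factors through the bosonization of the Nichols algebra. -/
theorem eq_zero_of_canonical_eq_zero (hβ : IsBosonPairing D D' form β) (a : Boson D (TV D))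
    (ha : canonical D (Nichols D) a = 0) : β a = 0 := by
  let φ := hβ.toConvAlgHom
  have hI : ∀ t, toNichols D t = 0 → φ.comp (inR D (TV D)) t = 0 := by
    intro t ht
    have h0 : tensorForm β t = 0 := hβ.tensorForm_eq_zero.2 ((toNichols_eq_zero D).1 ht)
    refine WithConv.ext (LinearMap.ext fun b => ?_)
    refine mem_of_inR_mul_inG (M := LinearMap.ker (β (inR D (TV D) t))) (fun s y => ?_) b
    rw [LinearMap.mem_ker, hβ.mul_inG_right, translate_inR, ← tensorForm_apply, h0,
      LinearMap.zero_apply]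
  let ψ : Boson D (Nichols D) →ₐ[k] WithConv (Boson D' (TV D') →ₗ[k] k) :=
    Boson.lift (descend (toNichols D) (toNichols_surjective D) (φ.comp (inR D (TV D))) hI)
      ((φ : Boson D (TV D) →* _).comp (inG D (TV D))) fun g r => by
        obtain ⟨t, rfl⟩ := toNichols_surjective D r
        rw [smul_toNichols, descend_apply, descend_apply]
        change φ (inR D (TV D) (g • t)) * φ (inG D (TV D) g) =
          φ (inG D (TV D) g) * φ (inR D (TV D) t)
        rw [← map_mul, ← map_mul, inG_mul_inR]
  have hψ : ψ.comp (canonicalAlgHom D (Nichols D)) = φ := by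
    refine Boson.algHom_ext (fun i => ?_) (fun g => ?_)
    · rw [AlgHom.comp_apply, canonicalAlgHom_bE, bE, lift_inR]
      exact descend_apply ..
    · rw [AlgHom.comp_apply, canonicalAlgHom_inG, lift_inG]
      rfl
  have h1 : φ a = ψ (canonical D (Nichols D) a) := congrArg (fun f => f a) hψ.symm
  rw [ha, map_zero] at h1
  exact congrArg WithConv.ofConv h1

theorem exists_descend (hβ : IsBosonPairing D D' form β) :
    ∃ ν : Boson D (Nichols D) →ₗ[k] Boson D' (Nichols D') →ₗ[k] k,
      ∀ a b, ν (canonical D (Nichols D) a) (canonical D' (Nichols D') b) = β a b :=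
  exists_descend_bilinear β (p := (canonicalAlgHom D (Nichols D)).toLinearMap)
    (q := (canonicalAlgHom D' (Nichols D')).toLinearMap) (canonical_surjective D (Nichols D))
    (canonical_surjective D' (Nichols D')) hβ.eq_zero_of_canonical_eq_zero
    hβ.flip.eq_zero_of_canonical_eq_zero

variable (hβ : IsBosonPairing D D' form β)
  {ν : Boson D (Nichols D) →ₗ[k] Boson D' (Nichols D') →ₗ[k] k}
  (hν : ∀ a b, ν (canonical D (Nichols D) a) (canonical D' (Nichols D') b) = β a b)

include hβ hν

theorem descended_mul_mul (r : Nichols D) (s : Nichols D') (x : Γ) (y : Λ) :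
    ν (inR D _ r * inG D _ x) (inR D' _ s * inG D' _ y) = ν (inR D _ r) (inR D' _ s) * form x y := by
  obtain ⟨r, rfl⟩ := BraidedQuotient.surj (D := D) r
  obtain ⟨s, rfl⟩ := BraidedQuotient.surj (D := D') s
  rw [← canonical_inR, ← canonical_inR, ← canonical_inG D (Nichols D),
    ← canonical_inG D' (Nichols D'), ← map_mul, ← map_mul,
    hν, hν, hβ.mul_mul]

theorem descended_separatingLeft_nichols :
    (ν.compl₁₂ (inR D (Nichols D)).toLinearMap (inR D' (Nichols D')).toLinearMap).SeparatingLeft := by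
  intro r hr
  obtain ⟨r, rfl⟩ := toNichols_surjective D r
  refine (toNichols_eq_zero D).2 (hβ.tensorForm_eq_zero.1 (LinearMap.ext fun t => ?_))
  have h1 := hr (toNichols D' t)
  rw [tensorForm_apply, ← hν, canonical_inR, canonical_inR]
  exact h1

/-- By the linear independence of distinct characters, the coefficients of a radical element pair
trivially with the Nichols algebra. -/
theorem descended_separatingLeft (h : ∀ x, (∀ y, form x y = 1) → x = 1) : ν.SeparatingLeft := by
  intro a ha
  obtain ⟨S, r, rfl⟩ := exists_eq_sum a
  have hinj : Function.Injective fun x : Γ => (Units.coeHom k).comp (form x) := by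
    intro x x' hx
    refine inv_mul_eq_one.1 (h _ fun y => ?_)
    have h1 : form x y = form x' y := Units.ext (DFunLike.congr_fun hx y)
    rw [map_mul, map_inv, MonoidHom.mul_apply, MonoidHom.inv_apply, h1, inv_mul_cancel]
  have hli := (linearIndependent_monoidHom Λ k).comp _ hinj
  refine Finset.sum_eq_zero fun x hx => ?_
  have h0 : r x = 0 := by
    refine descended_separatingLeft_nichols hβ hν _ fun s => ?_
    refine linearIndependent_iff'.1 hli S
      (fun x => ν (inR D (Nichols D) (r x)) (inR D' (Nichols D') s)) ?_ x hx
    funext y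
    have h1 := ha (inR D' (Nichols D') s * inG D' (Nichols D') y)
    rw [map_sum, LinearMap.sum_apply] at h1
    simpa [descended_mul_mul hβ hν] using h1
  rw [h0, map_zero, zero_mul]

theorem eq_one_of_descended_separatingLeft (h : ν.SeparatingLeft) (x : Γ)
    (hx : ∀ y, form x y = 1) : x = 1 := by
  refine inG_injective D (Nichols D) (sub_eq_zero.1 (h _ fun b => ?_))
  refine mem_of_inR_mul_inG (M := LinearMap.ker (ν (inG D (Nichols D) x - inG D (Nichols D) 1)))
    (fun s y => ?_) b
  have h1 := descended_mul_mul hβ hν 1 s x y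
  have h2 := descended_mul_mul hβ hν 1 s 1 y
  rw [map_one, one_mul, hx] at h1
  rw [map_one, one_mul, map_one form] at h2
  rw [LinearMap.mem_ker, map_sub, LinearMap.sub_apply, h1, h2, MonoidHom.one_apply, sub_self]

theorem descended_nondegenerate_nichols :
    (ν.compl₁₂ (inR D (Nichols D)).toLinearMap (inR D' (Nichols D')).toLinearMap).Nondegenerate :=
  ⟨descended_separatingLeft_nichols hβ hν,
    descended_separatingLeft_nichols hβ.flip (ν := ν.flip) fun b a => hν a b⟩

theorem descended_nondegenerate_iff : ν.Nondegenerate ↔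
    (∀ x, (∀ y, form x y = 1) → x = 1) ∧ ∀ y, (∀ x, form x y = 1) → y = 1 := by
  have hν' : ∀ b a, ν.flip (canonical D' (Nichols D') b) (canonical D (Nichols D) a) =
      β.flip b a := fun b a => hν a b
  constructor
  · rintro ⟨hl, hr⟩
    exact ⟨eq_one_of_descended_separatingLeft hβ hν hl,
      eq_one_of_descended_separatingLeft hβ.flip hν' hr⟩
  · rintro ⟨hl, hr⟩
    exact ⟨descended_separatingLeft hβ hν hl, descended_separatingLeft hβ.flip hν' hr⟩

end IsBosonPairing

namespace Datum

variable {θ : ℕ} (e : Datum k Γ Λ θ)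

theorem isDualPair : IsDualPair e.V e.W e.form where
  char_left := e.γ_eq
  char_right := e.lam_eq

theorem isTensorPairing_toCopForm
    {β : Boson e.V (TV e.V) →ₗ[k] Boson e.W (TV e.W) →ₗ[k] k} :
    e.IsTensorPairing (toCopForm β) ↔ IsBosonPairing e.V e.W e.form β := by
  constructor
  · intro h
    exact {
      toIsBialgebraPairing := isSkewHopfPairing_toCopForm.1 h.isSkewHopfPairing
      group_group := h.group_group
      E_F := h.E_F
      E_group := h.E_group
      group_F := h.group_F }
  · intro h
    exact {
      isSkewHopfPairing := isSkewHopfPairing_toCopForm.2 h.toIsBialgebraPairing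
      group_group := h.group_group
      E_F := h.E_F
      E_group := h.E_group
      group_F := h.group_F
      mul_mul := fun s t x y => by
        rw [show toCopForm β (e.inΓ x) (e.inΛ y) = _ from h.group_group x y]
        exact h.mul_mul s t x y }

end Datum

end

end SkewPairing

end

theorem mainTheorem1 {k Γ Λ : Type*} [Field k] [IsAlgClosed k] [CharZero k]
    [CommGroup Γ] [CommGroup Λ] {θ : ℕ} (e : SkewPairing.Datum k Γ Λ θ) :
    (∃! μ : e.TensorPos →ₗ[k] e.TensorNeg →ₗ[k] k, e.IsTensorPairing μ) ∧
    ∀ μ : e.TensorPos →ₗ[k] e.TensorNeg →ₗ[k] k, e.IsTensorPairing μ →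
      ∃ ν : e.NicholsPos →ₗ[k] e.NicholsNeg →ₗ[k] k,
        (∀ a b, ν (e.projV a) (e.projW b) = μ a b) ∧
        (∀ ν' : e.NicholsPos →ₗ[k] e.NicholsNeg →ₗ[k] k,
          (∀ a b, ν' (e.projV a) (e.projW b) = μ a b) → ν' = ν) ∧
        SkewPairing.IsSkewHopfPairing ν ∧
        (ν.compl₁₂ e.inBV.toLinearMap e.inBW.toLinearMap).Nondegenerate ∧
        (ν.Nondegenerate ↔ e.FormNondegenerate) := by
  open SkewPairing in
  refine ⟨⟨toCopForm (bosonForm e.isDualPair),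
    e.isTensorPairing_toCopForm.2 (bosonForm_isBosonPairing e.isDualPair), fun μ hμ => ?_⟩,
    fun μ hμ => ?_⟩
  · obtain ⟨β, rfl⟩ := toCopForm.surjective μ
    rw [e.isTensorPairing_toCopForm] at hμ
    rw [hμ.unique (bosonForm_isBosonPairing e.isDualPair)]
  · obtain ⟨β, rfl⟩ := toCopForm.surjective μ
    rw [e.isTensorPairing_toCopForm] at hμ
    obtain ⟨ν, hν⟩ := hμ.exists_descend
    have hV : Function.Surjective e.projV := Boson.canonical_surjective e.V (Nichols e.V)
    have hW : Function.Surjective e.projW := Boson.canonical_surjective e.W (Nichols e.W)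
    refine ⟨toCopForm ν, hν, fun ν' hν' => ?_, ?_, ?_, ?_⟩
    · refine LinearMap.ext fun a => LinearMap.ext fun b => ?_
      obtain ⟨a, rfl⟩ := hV a
      obtain ⟨b, rfl⟩ := hW b
      exact (hν' a b).trans (hν a b).symm
    · exact isSkewHopfPairing_toCopForm.2 (hμ.toIsBialgebraPairing.descend _ _
        (Boson.canonical_surjective e.V (Nichols e.V))
        (Boson.canonical_surjective e.W (Nichols e.W)) hν)
    · exact hμ.descended_nondegenerate_nichols hν
    · exact hμ.descended_nondegenerate_iff hν
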